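/- **Model.** Let $n,p$ be fixed, $\mathcal X\subseteq\mathbb R^p$ measurable, $\mathcal Y\subseteq\mathbb R^n$, $A\in\mathbb R^{n\times p}$, $x_{\rm true}\in\mathcal X$, $G$ a differentiable injective link function on $A\mathcal X$, $y_{\rm exact}=G(Ax_{\rm true})\in\mathcal Y$. For small $\tau>0$ and $x\in\mathcal X$ let $p_\tau(y\mid x)=C_{y,\tau}\exp\{-\tilde f_y(Ax)/\tau\}$, where $\tilde f_y(\eta)=\mathring f_y(G(\eta))$, be a probability density with respect to a $\sigma$-finite reference measure carried by $\mathcal Y$ (such as Lebesgue or counting measure), and let $Y=Y_\tau$ have density $p_\tau(\cdot\mid x_{\rm true})$. Assume that for every $\mu_0\in A\mathcal X$ the function $\tilde f_{G(\mu_0)}$ has its unique minimum over $A\mathcal X$ at $\mu_0$. The prior density is proportional to $\exp\{-g(x)/\gamma^2\}$ on $\mathcal X$ (possibly improper), $\gamma=\gamma(\tau)>0$, $\nu=\tau/\gamma^2$, $h_y(x)=\tilde f_y(Ax)+\nu g(x)$, and the posterior $\mu_{\rm post}$ has density proportional to $\exp\{-h_Y(x)/\tau\}$ on $\mathcal X$;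 assume that $\int_{\mathcal X}e^{-h_y/\tau}dx<\infty$ for all $y\in\mathcal Y$ and all small $\tau$. **Distances.** $\rho_K(\xi_1,\xi_2)=\inf\{\varepsilon>0:\mathbb P(d(\xi_1,\xi_2)>\varepsilon)<\varepsilon\}$ is the Ky Fan distance; $d$ is the Euclidean distance for data and the Prokhorov distance for random probability measures on $\mathbb R^p$. Matrix norms are spectral norms. Write $\rho=\rho_K(Y,y_{\rm exact})$ and $\mathcal Y_{\rm loc}=\{y\in\mathcal Y:\|y-y_{\rm exact}\|\le\rho\}$. **Assumptions.** All conditions are required for all sufficiently small $\tau$, and $B(x^\star,\delta)$ is the closed ball. 1. $x^\star$ is the unique minimiser of $g$ over $\{x\in\mathcal X:Ax=Ax_{\rm true}\}$, and an interior point of $\mathcal X$. 2. There are $\delta=\delta(\tau)>0$ and fixed positive definite matrices $C_f,C_g,M_1,M_2$ such that for $y\in\mathcal Y_{\rm loc}$ and $x\in B(x^\star,\delta)$ the functions $\tilde f_y$ and $g$ are $C^2$ at $Ax$ and at $x$, respectively, and, for all $v$ in $\mathbb R^n$ or $\mathbb R^p$ and $W\in\mathbb R^{p\times n}$, $|v^T(\nabla^2\tilde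 f_y(Ax)-\nabla^2\tilde f_y(Ax^\star))v|\le\delta\|A\|v^TC_fv$, $\;|v^T(\nabla^2g(x)-\nabla^2g(x^\star))v|\le\delta v^TC_gv$, $\|W(\nabla\tilde f_y(Ax^\star)-\nabla\tilde f_{y_{\rm exact}}(Ax^\star))\|\le\|WM_1(y-y_{\rm exact})\|$, $|v^T(\nabla^2\tilde f_y(Ax^\star)-\nabla^2\tilde f_{y_{\rm exact}}(Ax^\star))v|\le v^TM_2^{1/2}\mathrm{diag}(|y_j-y_{{\rm exact},j}|)M_2^{1/2}v$. 3. $V=\nabla^2\tilde f_{y_{\rm exact}}(Ax^\star)$ is positive definite, and so is $H_\nu=A^TVA+\nu\nabla^2g(x^\star)$ for $\nu=\nu(\tau)$. 4. As $\tau\to0$: $\delta\to0$, $\delta/\sqrt\tau\to\infty$, $(\rho+\nu)/\delta\to0$, and, if $A^TA$ is not of full rank, $\delta/\gamma\to\infty$. 5. The tail ratio $\Delta_0(y)=\int_{\mathcal X\setminus B(x^\star,\delta)}e^{-[h_y(x)-h_y(x^\star)]/\tau}dx\big/\int_{\mathcal X\cap B(x^\star,\delta)}e^{-[h_y(x)-h_y(x^\star)]/\tau}dx$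 tends to $0$ uniformly over $y\in\mathcal Y_{\rm loc}$, and is negligible: for some constant $K$, $\Delta_0(y)/(1+\Delta_0(y))\le K\,U_\tau(\nu)$ for all $y\in\mathcal Y_{\rm loc}$, where $$U_\tau(\nu)=\max\Big\{2\rho,\ \|H_\nu^{-1}A^TM_1\|\rho+\|H_\nu^{-1}\nabla g(x^\star)\|\nu+\big[-4\tau\,\mathrm{tr}(H_\nu^{-1})\log(4\tau\,\mathrm{tr}(H_\nu^{-1}))\big]^{1/2}\Big\}.$$ 6. $\rho\le C\sqrt{-\tau\log\tau}$ for some constant $C$. **Conclusion.** Let $P_A$ be the orthogonal projection onto the range of $A^T$. Constants below do not depend on $\tau$. *Well-posed case ($A^TVA$ of full rank).* If $\gamma^2\ge\tau^{1/2}(-\log\tau)^{-1/2}$ for all small $\tau$, then there is $C_1$ such that for all small $\tau$ both $U_\tau(\nu)$ and $\rho_K(\mu_{\rm post},\delta_{x_{\rm true}})$ are at most $C_1(-\tau\log\tau)^{1/2}$. This is the smallest order of the bound: if $p\ge1$, there are $a,\kappa>0$ such that for all small $\tau$, $U_\tau(\nu')\ge a(-\tau\log\tau)^{1/2}$ for every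 $0<\nu'<\kappa$. *Ill-posed case ($A^TVA$ not of full rank).* If $\gamma^2=\tau^{2/3}(-\log\tau)^{-1/3}$ for all small $\tau$, then there is $C_2$ such that for all small $\tau$, $U_\tau(\nu)\le C_2(-\tau\log\tau)^{1/3}$ and $$\rho_K(\mu_{\rm post},\delta_{x_{\rm true}})\le\|(I-P_A)(x_{\rm true}-x^\star)\|+C_2(-\tau\log\tau)^{1/3}.$$ This is the smallest order of the bound: if $\nabla g(x^\star)\neq0$, there are $a,\kappa>0$ such that for all small $\tau$, $U_\tau(\nu')\ge a(-\tau\log\tau)^{1/3}$ for every $\nu'$ with $0<\nu'<\kappa$ and $\tau/\nu'<\kappa$. -/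

import Mathlib

open MeasureTheory Filter Topology
open scoped ENNReal Matrix

noncomputable section

/-- The Ky Fan distance of two random elements `ξ₁, ξ₂ : Ω → W` with respect to a distance function
`d` on `W`: the infimum of all `ε > 0` with `P (d ξ₁ ξ₂ > ε) < ε`. -/
def kyFanDist {Ω W : Type*} [MeasurableSpace Ω] (P : Measure Ω) (d : W → W → ℝ)
    (ξ₁ ξ₂ : Ω → W) : ℝ :=
  sInf {ε : ℝ | 0 < ε ∧ P {ω | ε < d (ξ₁ ω) (ξ₂ ω)} < ENNReal.ofReal ε}

/-- The matrix of second partial derivatives of `F` at `x`. -/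
def hessianMatrix {m : ℕ} (F : EuclideanSpace ℝ (Fin m) → ℝ) (x : EuclideanSpace ℝ (Fin m)) :
    Matrix (Fin m) (Fin m) ℝ :=
  Matrix.of fun i j =>
    fderiv ℝ (fderiv ℝ F) x (EuclideanSpace.single i 1) (EuclideanSpace.single j 1)

/-- The spectral norm of a rectangular matrix (operator norm for the Euclidean norms). -/
def matrixSpectralNorm {k m : ℕ} (M : Matrix (Fin k) (Fin m) ℝ) : ℝ :=
  ‖LinearMap.toContinuousLinearMap (Matrix.toEuclideanLin M)‖

/-- The data of a generalised linear inverse problem with `n` observations and `p` unknowns: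
parameter set `X`, observation set `Y`, matrix `A`, link function `G`, the function
`(y, η) ↦ fring y η` for which the density of an observation `y` is proportional (in `η`) to
`exp (- fring y η / τ)`, the function `g` for which the prior density is proportional to
`exp (- g x / γ ^ 2)`, and the true value `xtrue` of the unknown. -/
structure InverseProblem (n p : ℕ) where
  X : Set (EuclideanSpace ℝ (Fin p))
  Y : Set (EuclideanSpace ℝ (Fin n))
  A : Matrix (Fin n) (Fin p) ℝ
  G : EuclideanSpace ℝ (Fin n) → EuclideanSpace ℝ (Fin n)
  fring : EuclideanSpace ℝ (Fin n) → EuclideanSpace ℝ (Fin n) → ℝ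
  g : EuclideanSpace ℝ (Fin p) → ℝ
  xtrue : EuclideanSpace ℝ (Fin p)

namespace InverseProblem

variable {n p : ℕ} (M : InverseProblem n p)

/-- The linear map `x ↦ A x`. -/
def fwd (x : EuclideanSpace ℝ (Fin p)) : EuclideanSpace ℝ (Fin n) :=
  Matrix.toEuclideanLin M.A x

/-- The exact data `G (A xtrue)`. -/
def yexact : EuclideanSpace ℝ (Fin n) := M.G (M.fwd M.xtrue)

/-- The scaled negative log likelihood as a function of `η = A x`. -/
def ftil (y η : EuclideanSpace ℝ (Fin n)) : ℝ := M.fring y (M.G η)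

/-- The scaled negative log posterior density `h_y(x) = f_y(x) + ν g(x)`, up to a constant. -/
def h (ν : ℝ) (y : EuclideanSpace ℝ (Fin n)) (x : EuclideanSpace ℝ (Fin p)) : ℝ :=
  M.ftil y (M.fwd x) + ν * M.g x

/-- The posterior density on `X` before normalisation, as a measure. -/
def posteriorUnnormalised (τ ν : ℝ) (y : EuclideanSpace ℝ (Fin n)) :
    Measure (EuclideanSpace ℝ (Fin p)) :=
  (volume.restrict M.X).withDensity fun x => ENNReal.ofReal (Real.exp (-(M.h ν y x) / τ))

/-- The posterior distribution given the observation `y`, for dispersion `τ` and `ν = τ / γ ^ 2`. -/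
def posterior (τ ν : ℝ) (y : EuclideanSpace ℝ (Fin n)) : Measure (EuclideanSpace ℝ (Fin p)) :=
  (M.posteriorUnnormalised τ ν y Set.univ)⁻¹ • M.posteriorUnnormalised τ ν y

/-- `xs` is the unique minimiser of `g` over all `x ∈ X` with `A x = A xtrue`. -/
def IsPriorMinimiser (xs : EuclideanSpace ℝ (Fin p)) : Prop :=
  xs ∈ M.X ∧ M.fwd xs = M.fwd M.xtrue ∧
    ∀ x ∈ M.X, M.fwd x = M.fwd M.xtrue → x ≠ xs → M.g xs < M.g x

/-- The matrix `V_y(x)` of second derivatives of the scaled negative log likelihood at `A x`. -/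
def V (y : EuclideanSpace ℝ (Fin n)) (x : EuclideanSpace ℝ (Fin p)) : Matrix (Fin n) (Fin n) ℝ :=
  hessianMatrix (M.ftil y) (M.fwd x)

/-- The matrix `Aᵀ V A`, where `V` is taken at the exact data and at `xs`. -/
def information (xs : EuclideanSpace ℝ (Fin p)) : Matrix (Fin p) (Fin p) ℝ :=
  M.Aᵀ * M.V M.yexact xs * M.A

/-- The matrix `H_ν = Aᵀ V A + ν B`, where `V` and the Hessian `B` of `g` are taken at `xs`
and the data are exact. -/
def Hnu (xs : EuclideanSpace ℝ (Fin p)) (ν : ℝ) : Matrix (Fin p) (Fin p) ℝ :=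
  M.information xs + ν • hessianMatrix M.g xs

/-- The orthogonal projection of `ℝᵖ` onto the range of `Aᵀ`. -/
def PA : EuclideanSpace ℝ (Fin p) →L[ℝ] EuclideanSpace ℝ (Fin p) :=
  (LinearMap.range (Matrix.toEuclideanLin M.Aᵀ)).starProjection

/-- The observations within distance `r` of the exact data. -/
def Yloc (r : ℝ) : Set (EuclideanSpace ℝ (Fin n)) := {y | y ∈ M.Y ∧ ‖y - M.yexact‖ ≤ r}

/-- The ratio of the unnormalised posterior mass outside the ball of radius `δ` about `xs` to
the one inside. -/
def tailRatio (xs : EuclideanSpace ℝ (Fin p)) (τ ν δ : ℝ) (y : EuclideanSpace ℝ (Fin n)) : ℝ :=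
  (∫ x in M.X \ Metric.closedBall xs δ, Real.exp (-(M.h ν y x - M.h ν y xs) / τ)) /
    ∫ x in M.X ∩ Metric.closedBall xs δ, Real.exp (-(M.h ν y x - M.h ν y xs) / τ)

/-- The leading part of the upper bound for the Ky Fan distance between the posterior distribution
and the point mass at `xs`, when the Ky Fan distance of the data to the exact data is `r`:
`max (2 r) (c₁ r + c₂ ν + (- s log s) ^ (1 / 2))` with `c₁ = ‖H_ν⁻¹ Aᵀ M₁‖`,
`c₂ = ‖H_ν⁻¹ ∇g(xs)‖` and `s = 4 τ tr (H_ν⁻¹)`. -/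
def leadingBound (xs : EuclideanSpace ℝ (Fin p)) (M₁ : Matrix (Fin n) (Fin n) ℝ) (r τ ν : ℝ) : ℝ :=
  max (2 * r)
    (matrixSpectralNorm ((M.Hnu xs ν)⁻¹ * M.Aᵀ * M₁) * r
      + ‖Matrix.toEuclideanLin (M.Hnu xs ν)⁻¹ (gradient M.g xs)‖ * ν
      + √(-(4 * τ * (M.Hnu xs ν)⁻¹.trace * Real.log (4 * τ * (M.Hnu xs ν)⁻¹.trace))))

/-- The statistical model. For every small `τ > 0` and every `x ∈ X`, the function
`y ↦ c τ y * exp (- ftil y (A x) / τ)` is a probability density with respect to a reference measure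
`refm τ` carried by `Y` (e.g. Lebesgue measure or a counting measure), and the observation
`obs τ` has this density for `x = xtrue`. The link function is differentiable and invertible
on `A X`, and the likelihood identifies `η`: for the exact data `G μ₀`, the function
`ftil (G μ₀)` has its unique minimum over `A X` at `μ₀`. -/
structure IsModel {Ω : Type*} [MeasurableSpace Ω] (P : Measure Ω)
    (refm : ℝ → Measure (EuclideanSpace ℝ (Fin n))) (c : ℝ → EuclideanSpace ℝ (Fin n) → ℝ)
    (obs : ℝ → Ω → EuclideanSpace ℝ (Fin n)) : Prop where
  measurableSet_X : MeasurableSet M.X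
  xtrue_mem : M.xtrue ∈ M.X
  yexact_mem : M.yexact ∈ M.Y
  differentiableOn_link : DifferentiableOn ℝ M.G (M.fwd '' M.X)
  injOn_link : Set.InjOn M.G (M.fwd '' M.X)
  sigmaFinite_refm : ∀ᶠ τ in 𝓝[>] (0 : ℝ), SigmaFinite (refm τ)
  refm_compl : ∀ᶠ τ in 𝓝[>] (0 : ℝ), refm τ M.Yᶜ = 0
  norm_const_nonneg : ∀ᶠ τ in 𝓝[>] (0 : ℝ), ∀ y, 0 ≤ c τ y
  aemeasurable_density : ∀ᶠ τ in 𝓝[>] (0 : ℝ), ∀ x ∈ M.X,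
    AEMeasurable (fun y => c τ y * Real.exp (-(M.ftil y (M.fwd x)) / τ)) (refm τ)
  lintegral_density : ∀ᶠ τ in 𝓝[>] (0 : ℝ), ∀ x ∈ M.X,
    ∫⁻ y, ENNReal.ofReal (c τ y * Real.exp (-(M.ftil y (M.fwd x)) / τ)) ∂(refm τ) = 1
  measurable_obs : ∀ᶠ τ in 𝓝[>] (0 : ℝ), Measurable (obs τ)
  law_obs : ∀ᶠ τ in 𝓝[>] (0 : ℝ), P.map (obs τ) = (refm τ).withDensity fun y =>
    ENNReal.ofReal (c τ y * Real.exp (-(M.ftil y (M.fwd M.xtrue)) / τ))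
  identifiable : ∀ μ₀ ∈ M.fwd '' M.X, ∀ η ∈ M.fwd '' M.X, η ≠ μ₀ →
    M.ftil (M.G μ₀) μ₀ < M.ftil (M.G μ₀) η

/-- Smoothness in `x` on the ball of radius `δ` about `xs`, for all `y ∈ Yloc r`: second
derivatives exist, are continuous, and vary by at most `δ` times a quadratic form. -/
structure SmoothNear (xs : EuclideanSpace ℝ (Fin p)) (Cf : Matrix (Fin n) (Fin n) ℝ)
    (Cg : Matrix (Fin p) (Fin p) ℝ) (r δ : ℝ) : Prop where
  contDiffAt_ftil : ∀ y ∈ M.Yloc r, ∀ x ∈ Metric.closedBall xs δ,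
    ContDiffAt ℝ 2 (M.ftil y) (M.fwd x)
  contDiffAt_g : ∀ x ∈ Metric.closedBall xs δ, ContDiffAt ℝ 2 M.g x
  hessian_ftil : ∀ y ∈ M.Yloc r, ∀ x ∈ Metric.closedBall xs δ, ∀ v : Fin n → ℝ,
    |v ⬝ᵥ (M.V y x - M.V y xs) *ᵥ v| ≤ δ * matrixSpectralNorm M.A * (v ⬝ᵥ Cf *ᵥ v)
  hessian_g : ∀ x ∈ Metric.closedBall xs δ, ∀ v : Fin p → ℝ,
    |v ⬝ᵥ (hessianMatrix M.g x - hessianMatrix M.g xs) *ᵥ v| ≤ δ * (v ⬝ᵥ Cg *ᵥ v)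

/-- Continuity in `y ∈ Yloc r` of the first two derivatives of the log likelihood at `A xs`.
Here `S₂` plays the role of the positive definite square root of the matrix `M₂`. -/
structure ConvergesInY (xs : EuclideanSpace ℝ (Fin p)) (M₁ S₂ : Matrix (Fin n) (Fin n) ℝ)
    (r : ℝ) : Prop where
  gradient_ftil : ∀ y ∈ M.Yloc r, ∀ W : Matrix (Fin p) (Fin n) ℝ,
    ‖Matrix.toEuclideanLin W
        (gradient (M.ftil y) (M.fwd xs) - gradient (M.ftil M.yexact) (M.fwd xs))‖
      ≤ ‖Matrix.toEuclideanLin (W * M₁) (y - M.yexact)‖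
  hessian_ftil : ∀ y ∈ M.Yloc r, ∀ v : Fin n → ℝ,
    |v ⬝ᵥ (M.V y xs - M.V M.yexact xs) *ᵥ v|
      ≤ v ⬝ᵥ (S₂ * Matrix.diagonal (fun j => |y j - M.yexact j|) * S₂) *ᵥ v

end InverseProblem

end

/-! Near `xs` the posterior is squeezed between two Gaussians, uniformly as `ν → 0`. Since `M.Hnu xs
ν` is affine in `ν` and positive definite at one `ν₀`, it dominates `c (‖A u‖² + ν ‖u‖²)` for all
small `ν` (`exists_le_inner_Hnu`). The likelihood contributes a Taylor error `O(δ + ρ) ‖A u‖²` and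
the prior one of `O(δ) ν ‖u‖²`, so both are small relative to this form. Hence, after centring at
the mode, `h` lies between 1/4 and 3/4 of the quadratic form (`exists_mode`).

The gradient of `h` at `xs` is `O(ρ + ν)` and vanishes on `ker A`: the exact likelihood is
stationary along the range of `A`, and `g` is stationary along `ker A`. So the mode is within `O(ρ +
ν)` of `xs`, with a constant free of `ν`; its kernel component is controlled because the mode
minimises `g` in comparison with points having the same image under `A`.

If `θ` bounds the eigenvalues of `H_ν` from below, Gaussian comparison leaves mass `O(τ)`, plus the
tail term, beyond radius `O(ρ + ν + √(-τ log τ / θ))` (`exists_posterior_le`). Data outside `Yloc`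
have probability at most `ρ`, which gives the Ky Fan bound (`exists_kyFanDist_posterior_le`). In the
well-posed case `θ` is constant. In the ill-posed case `θ = c ν`, and equating `ν` with `√(-τ log τ
/ ν)` gives the exponent 1/3.

For the converse, `‖H_ν‖` is bounded. In the well-posed case this bounds the trace of the inverse
below. In the ill-posed case it makes the bias term at least of order `ν`, while a unit kernel
vector forces the trace to be at least of order `1 / ν`; one of the two terms always reaches the
balanced rate. -/

section LinearAlgebra

/-! ### Quadratic forms, traces of inverses, kernels and ranges. -/

variable {a b c : ℕ}

lemma inner_toEuclideanLin_eq_dotProduct (H : Matrix (Fin a) (Fin b) ℝ)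
    (u : EuclideanSpace ℝ (Fin a)) (v : EuclideanSpace ℝ (Fin b)) :
    inner ℝ u (Matrix.toEuclideanLin H v) = u.ofLp ⬝ᵥ H *ᵥ v.ofLp := by
  rw [EuclideanSpace.inner_eq_star_dotProduct, dotProduct_comm]
  simp [Matrix.toLpLin_apply]

lemma inner_toEuclideanLin_transpose (H : Matrix (Fin a) (Fin b) ℝ)
    (u : EuclideanSpace ℝ (Fin b)) (v : EuclideanSpace ℝ (Fin a)) :
    inner ℝ u (Matrix.toEuclideanLin Hᵀ v) = inner ℝ (Matrix.toEuclideanLin H u) v := by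
  have := Matrix.toEuclideanLin_conjTranspose_eq_adjoint (𝕜 := ℝ) H
  rw [Matrix.conjTranspose_eq_transpose_of_trivial] at this
  rw [this, LinearMap.adjoint_inner_right]

lemma toEuclideanLin_mul_apply (H : Matrix (Fin a) (Fin b) ℝ) (J : Matrix (Fin b) (Fin c) ℝ)
    (u : EuclideanSpace ℝ (Fin c)) :
    Matrix.toEuclideanLin (H * J) u = Matrix.toEuclideanLin H (Matrix.toEuclideanLin J u) := by
  simp [Matrix.toLpLin_apply, Matrix.mulVec_mulVec]

lemma norm_toEuclideanLin_le (H : Matrix (Fin a) (Fin b) ℝ) (u : EuclideanSpace ℝ (Fin b)) :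
    ‖Matrix.toEuclideanLin H u‖ ≤ matrixSpectralNorm H * ‖u‖ :=
  (LinearMap.toContinuousLinearMap (Matrix.toEuclideanLin H)).le_opNorm u

lemma matrixSpectralNorm_nonneg (H : Matrix (Fin a) (Fin b) ℝ) : 0 ≤ matrixSpectralNorm H :=
  norm_nonneg _

lemma matrixSpectralNorm_le {H : Matrix (Fin a) (Fin b) ℝ} {K : ℝ} (hK : 0 ≤ K)
    (h : ∀ u, ‖Matrix.toEuclideanLin H u‖ ≤ K * ‖u‖) : matrixSpectralNorm H ≤ K :=
  ContinuousLinearMap.opNorm_le_bound _ hK h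

lemma abs_inner_toEuclideanLin_le (H : Matrix (Fin a) (Fin b) ℝ) (u : EuclideanSpace ℝ (Fin a))
    (v : EuclideanSpace ℝ (Fin b)) :
    |inner ℝ u (Matrix.toEuclideanLin H v)| ≤ matrixSpectralNorm H * (‖u‖ * ‖v‖) := by
  refine (abs_real_inner_le_norm _ _).trans ?_
  nlinarith [norm_toEuclideanLin_le H v, norm_nonneg u]

lemma Matrix.PosDef.inner_toEuclideanLin_pos {H : Matrix (Fin a) (Fin a) ℝ} (hH : H.PosDef)
    {u : EuclideanSpace ℝ (Fin a)} (hu : u ≠ 0) : 0 < inner ℝ u (Matrix.toEuclideanLin H u) := by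
  rw [inner_toEuclideanLin_eq_dotProduct]
  have := hH.dotProduct_mulVec_pos (x := u.ofLp) (by simpa using hu)
  simpa using this

lemma Matrix.PosDef.exists_mul_norm_sq_le_inner {H : Matrix (Fin a) (Fin a) ℝ} (hH : H.PosDef) :
    ∃ k > 0, ∀ u, k * ‖u‖ ^ 2 ≤ inner ℝ u (Matrix.toEuclideanLin H u) := by
  -- The unit sphere is empty exactly in dimension zero, where any constant works.
  rcases (Metric.sphere (0 : EuclideanSpace ℝ (Fin a)) 1).eq_empty_or_nonempty with he | hne
  · refine ⟨1, one_pos, fun u => ?_⟩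
    have hu : u = 0 := by
      by_contra hu
      have : (‖u‖⁻¹ • u) ∈ Metric.sphere (0 : EuclideanSpace ℝ (Fin a)) 1 := by
        simp [norm_smul, hu]
      simp [he] at this
    simp [hu]
  have hcont : Continuous fun u : EuclideanSpace ℝ (Fin a) =>
      inner ℝ u (Matrix.toEuclideanLin H u) :=
    continuous_id.inner (LinearMap.continuous_of_finiteDimensional _)
  obtain ⟨v, hv, hmin⟩ := (isCompact_sphere _ _).exists_isMinOn hne hcont.continuousOn
  have hv1 : ‖v‖ = 1 := by simpa using hv
  have hv0 : v ≠ 0 := by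
    rintro rfl
    simp at hv1
  refine ⟨_, hH.inner_toEuclideanLin_pos hv0, fun u => ?_⟩
  rcases eq_or_ne u 0 with rfl | hu
  · simp
  have hu' : 0 < ‖u‖ := norm_pos_iff.2 hu
  have hmem : (‖u‖⁻¹ • u) ∈ Metric.sphere (0 : EuclideanSpace ℝ (Fin a)) 1 := by
    simp [norm_smul, hu]
  have h1 := hmin hmem
  simp only [Set.mem_ofPred_eq, map_smul, inner_smul_left, inner_smul_right, RCLike.conj_to_real] at h1
  calc _ ≤ ‖u‖⁻¹ * (‖u‖⁻¹ * inner ℝ u (Matrix.toEuclideanLin H u)) * ‖u‖ ^ 2 := by gcongr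
    _ = _ := by field_simp

lemma Matrix.PosDef.toEuclideanLin_inv_apply {H : Matrix (Fin a) (Fin a) ℝ} (hH : H.PosDef)
    (u : EuclideanSpace ℝ (Fin a)) :
    Matrix.toEuclideanLin H (Matrix.toEuclideanLin H⁻¹ u) = u := by
  rw [← toEuclideanLin_mul_apply, Matrix.mul_nonsing_inv _ ((Matrix.isUnit_iff_isUnit_det _).1 hH.isUnit)]
  simp

lemma inner_single_toEuclideanLin (H : Matrix (Fin a) (Fin b) ℝ) (i : Fin a) (j : Fin b) :
    inner ℝ (EuclideanSpace.single i (1 : ℝ))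
      (Matrix.toEuclideanLin H (EuclideanSpace.single j 1)) = H i j := by
  rw [inner_toEuclideanLin_eq_dotProduct]
  simp

/-- For `w = H⁻¹ e` with `e` a basis vector, `θ ‖w‖² ≤ ⟪w, H w⟫ = ⟪w, e⟫ ≤ ‖w‖`, so each diagonal
entry of `H⁻¹` is at most `1 / θ`. No diagonalisation is needed. -/
lemma Matrix.PosDef.trace_inv_le {H : Matrix (Fin a) (Fin a) ℝ} (hH : H.PosDef) {θ : ℝ}
    (hθ : 0 < θ) (h : ∀ u, θ * ‖u‖ ^ 2 ≤ inner ℝ u (Matrix.toEuclideanLin H u)) :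
    H⁻¹.trace ≤ a / θ := by
  have hentry : ∀ i, H⁻¹ i i ≤ 1 / θ := by
    intro i
    set e : EuclideanSpace ℝ (Fin a) := EuclideanSpace.single i (1 : ℝ) with he
    set w := Matrix.toEuclideanLin H⁻¹ e with hw
    have h1 : H⁻¹ i i = inner ℝ e w := (inner_single_toEuclideanLin _ i i).symm
    have hen : ‖e‖ = 1 := by simp [he]
    have h2 : inner ℝ e w ≤ ‖w‖ := by simpa [hen] using real_inner_le_norm e w
    have h3 := h w
    rw [hw, hH.toEuclideanLin_inv_apply, ← hw, real_inner_comm] at h3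
    rw [h1, le_div_iff₀ hθ]
    rcases (norm_nonneg w).eq_or_lt with h0 | h0
    · nlinarith
    · have : θ * ‖w‖ ≤ 1 := by nlinarith
      nlinarith
  calc H⁻¹.trace = ∑ i, H⁻¹ i i := rfl
    _ ≤ ∑ _i : Fin a, 1 / θ := Finset.sum_le_sum fun i _ => hentry i
    _ = a / θ := by simp [div_eq_mul_inv]

lemma Matrix.PosSemidef.inner_toEuclideanLin_le_trace {H : Matrix (Fin a) (Fin a) ℝ}
    (hH : H.PosSemidef) (u : EuclideanSpace ℝ (Fin a)) :
    inner ℝ u (Matrix.toEuclideanLin H u) ≤ H.trace * ‖u‖ ^ 2 := by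
  have hij : ∀ i j, 2 * (u i * (H i j * u j)) ≤ H i i * u j ^ 2 + H j j * u i ^ 2 := by
    intro i j
    -- Testing on `u_j e_i - u_i e_j` and summing over all pairs gives the trace bound.
    have h1 := hH.dotProduct_mulVec_nonneg (Pi.single i (u j) - Pi.single j (u i))
    have h2 : H j i = H i j := by simpa using congrFun (congrFun hH.isHermitian.eq i) j
    simp [Matrix.mulVec_sub, sub_dotProduct, dotProduct_sub, h2] at h1
    nlinarith
  rw [inner_toEuclideanLin_eq_dotProduct, EuclideanSpace.norm_sq_eq]
  have h1 := Finset.sum_le_sum fun i (_ : i ∈ Finset.univ) =>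
    Finset.sum_le_sum fun j (_ : j ∈ Finset.univ) => hij i j
  simp only [Finset.sum_add_distrib, ← Finset.mul_sum, ← Finset.sum_mul] at h1
  simp only [Matrix.trace, Matrix.diag, dotProduct, Matrix.mulVec, Real.norm_eq_abs, sq_abs]
  linarith

/-- Cauchy–Schwarz for the form `H`: positivity at `H⁻¹ v - s⁻¹ v` gives `⟪v, H⁻¹ v⟫ ≥ 1 / ⟪v, H
v⟫`. Test vectors thus bound the trace of the inverse from below. -/
lemma Matrix.PosDef.one_le_inner_mul_trace_inv {H : Matrix (Fin a) (Fin a) ℝ} (hH : H.PosDef)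
    {v : EuclideanSpace ℝ (Fin a)} (hv : ‖v‖ = 1) :
    1 ≤ inner ℝ v (Matrix.toEuclideanLin H v) * H⁻¹.trace := by
  have hv0 : v ≠ 0 := by
    rintro rfl
    simp at hv
  set s := inner ℝ v (Matrix.toEuclideanLin H v) with hs
  have hspos : 0 < s := hH.inner_toEuclideanLin_pos hv0
  set w := Matrix.toEuclideanLin H⁻¹ v with hw
  have hHw : Matrix.toEuclideanLin H w = v := hH.toEuclideanLin_inv_apply v
  have h1 : inner ℝ v w ≤ H⁻¹.trace := by
    simpa [hv] using hH.inv.posSemidef.inner_toEuclideanLin_le_trace v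
  have h2 : 0 ≤ inner ℝ (w - s⁻¹ • v) (Matrix.toEuclideanLin H (w - s⁻¹ • v)) := by
    rcases eq_or_ne (w - s⁻¹ • v) 0 with h0 | h0
    · simp [h0]
    · exact (hH.inner_toEuclideanLin_pos h0).le
  have hsym : inner ℝ w (Matrix.toEuclideanLin H v) = inner ℝ v v := by
    have := inner_toEuclideanLin_transpose H w v
    rw [← Matrix.conjTranspose_eq_transpose_of_trivial, hH.isHermitian.eq, hHw] at this
    exact this
  have hvv : inner ℝ v v = (1 : ℝ) := by rw [real_inner_self_eq_norm_sq, hv]; norm_num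
  have h3 : inner ℝ (w - s⁻¹ • v) (Matrix.toEuclideanLin H (w - s⁻¹ • v))
      = inner ℝ v w - s⁻¹ := by
    rw [map_sub, map_smul, hHw, inner_sub_left, inner_sub_right, inner_sub_right, inner_smul_left,
      inner_smul_right, inner_smul_right, inner_smul_left, hsym, hvv, ← hs, real_inner_comm]
    simp
    field_simp
    ring
  have h4 : s⁻¹ ≤ H⁻¹.trace := by linarith
  calc (1 : ℝ) = s * s⁻¹ := by field_simp
    _ ≤ _ := by gcongr

/-- Splitting a vector along the kernel of a linear map and its orthogonal complement. -/
lemma LinearMap.exists_add_mem_ker_norm_le {E F : Type*} [NormedAddCommGroup E]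
    [InnerProductSpace ℝ E] [FiniteDimensional ℝ E] [NormedAddCommGroup F] [NormedSpace ℝ F]
    (f : E →ₗ[ℝ] F) :
    ∃ D > 0, ∀ u, ∃ m k, u = m + k ∧ f k = 0 ∧ ‖m‖ ≤ D * ‖f u‖ ∧ ‖m‖ ≤ ‖u‖ := by
  set N := LinearMap.ker f
  -- Injectivity on the complement of the kernel makes `f` antilipschitz there; `D` is that
  -- constant.
  have hker : LinearMap.ker (f.domRestrict Nᗮ) = ⊥ := by
    rw [LinearMap.ker_eq_bot']
    intro m hm
    have h1 : (m : E) ∈ N := hm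
    have h2 := N.inner_right_of_mem_orthogonal h1 m.2
    have : (m : E) = 0 := by simpa using h2
    exact_mod_cast this
  obtain ⟨K, hK, hanti⟩ := LinearMap.exists_antilipschitzWith _ hker
  refine ⟨K, hK, fun u => ?_⟩
  have hk : f (N.starProjection u) = 0 := by
    exact (Submodule.starProjection_apply_mem N u : _)
  have hsum : u = Nᗮ.starProjection u + N.starProjection u := by
    rw [add_comm]
    exact (N.starProjection_add_starProjection_orthogonal u).symm
  refine ⟨Nᗮ.starProjection u, N.starProjection u, hsum, hk, ?_, ?_⟩
  · have h1 := hanti.le_mul_norm_sub (x := Nᗮ.orthogonalProjectionOnto u) (y := 0)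
    have h2 : f (Nᗮ.starProjection u) = f u := by
      conv_rhs => rw [hsum, map_add, hk, add_zero]
    rw [map_zero, add_zero, add_zero, norm_neg, norm_neg, LinearMap.domRestrict_apply] at h1
    rwa [← h2]
  · exact Submodule.norm_starProjection_apply_le _ _

/-- In finite dimension the range of `Aᵀ` equals its double orthogonal complement, whose inner
complement is `ker A`. This represents the gradient of the prior as `Aᵀ z`. -/
lemma exists_eq_toEuclideanLin_transpose (A : Matrix (Fin a) (Fin b) ℝ)
    {w : EuclideanSpace ℝ (Fin b)}
    (h : ∀ k, Matrix.toEuclideanLin A k = 0 → inner ℝ w k = 0) :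
    ∃ z, w = Matrix.toEuclideanLin Aᵀ z := by
  have h1 : w ∈ (LinearMap.range (Matrix.toEuclideanLin Aᵀ))ᗮᗮ := by
    rw [Submodule.mem_orthogonal]
    intro k hk
    rw [real_inner_comm]
    apply h
    rw [Submodule.mem_orthogonal] at hk
    have := hk _ ⟨Matrix.toEuclideanLin A k, rfl⟩
    rw [real_inner_comm, inner_toEuclideanLin_transpose] at this
    simpa using this
  rw [Submodule.orthogonal_orthogonal] at h1
  obtain ⟨z, hz⟩ := h1
  exact ⟨z, hz.symm⟩

end LinearAlgebra

/-! ### Bounds on `H_ν` and its inverse, uniform in small `ν`. -/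

namespace InverseProblem

variable {n p : ℕ} (M : InverseProblem n p)

lemma fwd_add (u v : EuclideanSpace ℝ (Fin p)) : M.fwd (u + v) = M.fwd u + M.fwd v :=
  map_add _ _ _

lemma fwd_sub (u v : EuclideanSpace ℝ (Fin p)) : M.fwd (u - v) = M.fwd u - M.fwd v :=
  map_sub _ _ _

lemma fwd_smul (t : ℝ) (u : EuclideanSpace ℝ (Fin p)) : M.fwd (t • u) = t • M.fwd u :=
  map_smul _ _ _

lemma exists_add_ker_norm_le : ∃ D > 0, ∀ u, ∃ m k, u = m + k ∧ M.fwd k = 0 ∧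
    ‖m‖ ≤ D * ‖M.fwd u‖ ∧ ‖m‖ ≤ ‖u‖ :=
  LinearMap.exists_add_mem_ker_norm_le (Matrix.toEuclideanLin M.A)

variable (xs : EuclideanSpace ℝ (Fin p))

lemma inner_information (u v : EuclideanSpace ℝ (Fin p)) :
    inner ℝ u (Matrix.toEuclideanLin (M.information xs) v)
      = inner ℝ (M.fwd u) (Matrix.toEuclideanLin (M.V M.yexact xs) (M.fwd v)) := by
  rw [information, toEuclideanLin_mul_apply, toEuclideanLin_mul_apply,
    inner_toEuclideanLin_transpose]
  rfl

lemma inner_Hnu (ν : ℝ) (u v : EuclideanSpace ℝ (Fin p)) :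
    inner ℝ u (Matrix.toEuclideanLin (M.Hnu xs ν) v)
      = inner ℝ (M.fwd u) (Matrix.toEuclideanLin (M.V M.yexact xs) (M.fwd v))
        + ν * inner ℝ u (Matrix.toEuclideanLin (hessianMatrix M.g xs) v) := by
  rw [Hnu, map_add, map_smul, LinearMap.add_apply, LinearMap.smul_apply, inner_add_right,
    inner_smul_right, inner_information]

/-- For `0 < ν ≤ ν₀` this is a convex combination, so positive definiteness at the single value `ν₀`
passes to all smaller `ν`. -/
lemma Hnu_eq_combination {ν₀ : ℝ} (hν₀ : 0 < ν₀) (ν : ℝ) :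
    M.Hnu xs ν = (ν / ν₀) • M.Hnu xs ν₀ + (1 - ν / ν₀) • M.information xs := by
  rw [Hnu, Hnu, smul_add, smul_smul, div_mul_cancel₀ _ hν₀.ne', sub_smul, one_smul]
  abel

variable {xs}

lemma information_posSemidef (hV : (M.V M.yexact xs).PosDef) :
    (M.information xs).PosSemidef := by
  have := hV.posSemidef.conjTranspose_mul_mul_same M.A
  rwa [Matrix.conjTranspose_eq_transpose_of_trivial] at this

lemma Hnu_posDef (hV : (M.V M.yexact xs).PosDef) {ν₀ ν : ℝ} (hν₀ : 0 < ν₀)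
    (hH : (M.Hnu xs ν₀).PosDef) (hν : 0 < ν) (hle : ν ≤ ν₀) : (M.Hnu xs ν).PosDef := by
  rw [M.Hnu_eq_combination xs hν₀]
  refine (hH.smul (div_pos hν hν₀)).add_posSemidef ((M.information_posSemidef hV).smul ?_)
  rw [sub_nonneg, div_le_one hν₀]
  exact hle

/-- The `H_{ν₀}` part supplies `ν ‖u‖²` and the information part supplies `‖A u‖²`; `ν ≤ ν₀ / 2`
keeps the weight of the latter at least 1/2. -/
lemma exists_le_inner_Hnu (hV : (M.V M.yexact xs).PosDef) {ν₀ : ℝ} (hν₀ : 0 < ν₀)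
    (hH : (M.Hnu xs ν₀).PosDef) : ∃ c > 0, ∀ ν, 0 < ν → ν ≤ ν₀ / 2 → ∀ u,
      c * (‖M.fwd u‖ ^ 2 + ν * ‖u‖ ^ 2) ≤ inner ℝ u (Matrix.toEuclideanLin (M.Hnu xs ν) u) := by
  obtain ⟨c₁, hc₁, h₁⟩ := hH.exists_mul_norm_sq_le_inner
  obtain ⟨c₂, hc₂, h₂⟩ := hV.exists_mul_norm_sq_le_inner
  refine ⟨min (c₁ / ν₀) (c₂ / 2), by positivity, fun ν hν hle u => ?_⟩
  rw [M.Hnu_eq_combination xs hν₀, map_add, map_smul, map_smul, LinearMap.add_apply,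
    LinearMap.smul_apply, LinearMap.smul_apply, inner_add_right, inner_smul_right,
    inner_smul_right, inner_information]
  have e1 : ν / ν₀ ≤ 1 / 2 := by rw [div_le_iff₀ hν₀]; linarith
  have e2 : min (c₁ / ν₀) (c₂ / 2) * (ν * ‖u‖ ^ 2)
      ≤ ν / ν₀ * inner ℝ u (Matrix.toEuclideanLin (M.Hnu xs ν₀) u) :=
    calc _ ≤ c₁ / ν₀ * (ν * ‖u‖ ^ 2) := by gcongr; exact min_le_left _ _
      _ = ν / ν₀ * (c₁ * ‖u‖ ^ 2) := by ring
      _ ≤ _ := by gcongr; exact h₁ u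
  have e3 : min (c₁ / ν₀) (c₂ / 2) * ‖M.fwd u‖ ^ 2 ≤ (1 - ν / ν₀) *
      inner ℝ (M.fwd u) (Matrix.toEuclideanLin (M.V M.yexact xs) (M.fwd u)) :=
    calc _ ≤ c₂ / 2 * ‖M.fwd u‖ ^ 2 := by gcongr; exact min_le_right _ _
      _ = (1 / 2) * (c₂ * ‖M.fwd u‖ ^ 2) := by ring
      _ ≤ (1 / 2) * inner ℝ (M.fwd u)
            (Matrix.toEuclideanLin (M.V M.yexact xs) (M.fwd u)) := by gcongr; exact h₂ _
      _ ≤ _ := by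
        gcongr
        · exact le_trans (by positivity) (h₂ (M.fwd u))
        · linarith
  linarith

lemma exists_norm_Hnu_le (xs : EuclideanSpace ℝ (Fin p)) : ∃ C > 0, ∀ ν, 0 < ν → ν ≤ 1 → ∀ u,
    ‖Matrix.toEuclideanLin (M.Hnu xs ν) u‖ ≤ C * ‖u‖ := by
  refine ⟨matrixSpectralNorm (M.information xs) + matrixSpectralNorm (hessianMatrix M.g xs) + 1,
    by linarith [matrixSpectralNorm_nonneg (M.information xs),
      matrixSpectralNorm_nonneg (hessianMatrix M.g xs)], fun ν hν hle u => ?_⟩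
  rw [Hnu, map_add, map_smul, LinearMap.add_apply, LinearMap.smul_apply]
  refine (norm_add_le _ _).trans ?_
  rw [norm_smul, Real.norm_of_nonneg hν.le]
  have h1 := norm_toEuclideanLin_le (M.information xs) u
  have h2 := norm_toEuclideanLin_le (hessianMatrix M.g xs) u
  have h3 : ν * ‖Matrix.toEuclideanLin (hessianMatrix M.g xs) u‖
      ≤ 1 * ‖Matrix.toEuclideanLin (hessianMatrix M.g xs) u‖ := by gcongr
  nlinarith [norm_nonneg u]

/-- On the kernel of the forward map the Hessian of the prior is positive definite. -/
lemma exists_le_inner_hessian_of_fwd_eq_zero {ν₀ : ℝ} (hν₀ : 0 < ν₀)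
    (hH : (M.Hnu xs ν₀).PosDef) : ∃ c > 0, ∀ k, M.fwd k = 0 →
      c * ‖k‖ ^ 2 ≤ inner ℝ k (Matrix.toEuclideanLin (hessianMatrix M.g xs) k) := by
  obtain ⟨c, hc, h⟩ := hH.exists_mul_norm_sq_le_inner
  refine ⟨c / ν₀, by positivity, fun k hk => ?_⟩
  have := h k
  rw [inner_Hnu, hk, map_zero, inner_zero_right, zero_add] at this
  rw [div_mul_eq_mul_div, div_le_iff₀ hν₀]
  linarith

/-- The matrices `H_ν⁻¹ Aᵀ` are uniformly bounded for small `ν`. -/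
lemma exists_norm_le_of_Hnu_eq (hV : (M.V M.yexact xs).PosDef) {ν₀ : ℝ} (hν₀ : 0 < ν₀)
    (hH : (M.Hnu xs ν₀).PosDef) : ∃ C > 0, ∀ ν, 0 < ν → ν ≤ ν₀ / 2 → ∀ z w,
      Matrix.toEuclideanLin (M.Hnu xs ν) w = Matrix.toEuclideanLin M.Aᵀ z → ‖w‖ ≤ C * ‖z‖ := by
  obtain ⟨c, hc, hlow⟩ := M.exists_le_inner_Hnu hV hν₀ hH
  obtain ⟨b, hb, hker⟩ := M.exists_le_inner_hessian_of_fwd_eq_zero hν₀ hH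
  obtain ⟨D, hD, hdec⟩ := M.exists_add_ker_norm_le
  set B := matrixSpectralNorm (hessianMatrix M.g xs)
  have hB : 0 ≤ B := matrixSpectralNorm_nonneg _
  refine ⟨(1 + B / b) * (D * c⁻¹), by positivity, fun ν hν hle z w hw => ?_⟩
  have hAw : ‖M.fwd w‖ ≤ c⁻¹ * ‖z‖ := by
    have h1 := hlow ν hν hle w
    rw [hw, inner_toEuclideanLin_transpose] at h1
    have h2 := real_inner_le_norm (M.fwd w) z
    have h3 : c * ‖M.fwd w‖ ^ 2 ≤ ‖M.fwd w‖ * ‖z‖ := by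
      refine le_trans ?_ (h1.trans h2)
      have : 0 ≤ ν * ‖w‖ ^ 2 := by positivity
      nlinarith
    rw [inv_mul_eq_div, le_div_iff₀ hc]
    rcases (norm_nonneg (M.fwd w)).eq_or_lt with h0 | h0
    · rw [← h0]; simp
    · nlinarith
  obtain ⟨m, k, hmk, hk, hm, -⟩ := hdec w
  -- Pairing the equation with `k ∈ ker A` kills the data terms; the remaining factor `ν` cancels,
  -- so the bound on `k` does not degenerate as `ν → 0`.
  have hkm : ‖k‖ ≤ B / b * ‖m‖ := by
    have h1 : inner ℝ k (Matrix.toEuclideanLin (M.Hnu xs ν) w) = 0 := by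
      rw [hw, inner_toEuclideanLin_transpose]
      change inner ℝ (M.fwd k) z = 0
      rw [hk, inner_zero_left]
    rw [inner_Hnu, hk, inner_zero_left, zero_add, hmk, map_add, inner_add_right] at h1
    have h2 := (mul_eq_zero.1 h1).resolve_left hν.ne'
    have h3 := abs_le.1 (abs_inner_toEuclideanLin_le (hessianMatrix M.g xs) k m)
    have h4 := hker k hk
    rw [div_mul_eq_mul_div, le_div_iff₀ hb]
    have h5 : b * ‖k‖ ^ 2 ≤ B * (‖k‖ * ‖m‖) := by linarith [h3.1]
    rcases (norm_nonneg k).eq_or_lt with h0 | h0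
    · rw [← h0]; simp; positivity
    · nlinarith
  calc ‖w‖ ≤ ‖m‖ + ‖k‖ := by rw [hmk]; exact norm_add_le _ _
    _ ≤ (1 + B / b) * ‖m‖ := by linarith
    _ ≤ (1 + B / b) * (D * (c⁻¹ * ‖z‖)) := by gcongr; exact hm.trans (by gcongr)
    _ = _ := by ring

lemma exists_mul_norm_le_fwd_of_rank_eq (h : (M.information xs).rank = p) :
    ∃ a > 0, ∀ u, a * ‖u‖ ≤ ‖M.fwd u‖ := by
  have hinj : LinearMap.ker (Matrix.toEuclideanLin M.A) = ⊥ := by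
    have h1 := LinearMap.finrank_range_add_finrank_ker (M.information xs).mulVecLin
    rw [← Matrix.rank, h] at h1
    have h2 : Module.finrank ℝ (LinearMap.ker (M.information xs).mulVecLin) = 0 := by
      simpa using h1
    rw [Submodule.finrank_eq_zero] at h2
    rw [LinearMap.ker_eq_bot']
    intro u hu
    have h3 : u.ofLp ∈ LinearMap.ker (M.information xs).mulVecLin := by
      have hu' : M.A *ᵥ u.ofLp = 0 := by simpa [Matrix.toLpLin_apply] using hu
      simp [information, hu']
    rw [h2] at h3
    simpa using h3
  obtain ⟨K, hK, hanti⟩ := LinearMap.exists_antilipschitzWith _ hinj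
  refine ⟨(K : ℝ)⁻¹, by positivity, fun u => ?_⟩
  have h1 := hanti.le_mul_norm_sub (x := u) (y := 0)
  rw [map_zero, add_zero, add_zero, norm_neg, norm_neg] at h1
  rw [inv_mul_le_iff₀ (by exact_mod_cast hK)]
  exact h1

lemma exists_norm_eq_one_fwd_eq_zero (hV : (M.V M.yexact xs).PosDef)
    (h : (M.information xs).rank < p) : ∃ k, ‖k‖ = 1 ∧ M.fwd k = 0 := by
  have h1 := LinearMap.finrank_range_add_finrank_ker (M.information xs).mulVecLin
  have h2 : 0 < Module.finrank ℝ (LinearMap.ker (M.information xs).mulVecLin) := by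
    have : Module.finrank ℝ (Fin p → ℝ) = p := by simp
    rw [← Matrix.rank, this] at h1
    omega
  have := Module.finrank_pos_iff.1 h2
  obtain ⟨⟨k, hk⟩, hk0⟩ := exists_ne (0 : LinearMap.ker (M.information xs).mulVecLin)
  set k' : EuclideanSpace ℝ (Fin p) := WithLp.toLp 2 k with hk'
  have hk'0 : k' ≠ 0 := by
    intro h0
    apply hk0
    have : k = 0 := by simpa [hk'] using h0
    simp [this]
  have hA : M.fwd k' = 0 := by
    by_contra hne
    have h3 := hV.inner_toEuclideanLin_pos hne
    rw [← inner_information] at h3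
    have h4 : Matrix.toEuclideanLin (M.information xs) k' = 0 := by
      rw [Matrix.toLpLin_apply, hk']
      simpa using hk
    simp [h4] at h3
  refine ⟨‖k'‖⁻¹ • k', by simp [norm_smul, hk'0], by rw [fwd_smul, hA, smul_zero]⟩

/-- Links the rank condition on `AᵀVA` to the one on `AᵀA` under which `δ / γ → ∞` is assumed. -/
lemma rank_transpose_mul_self_lt {k : EuclideanSpace ℝ (Fin p)} (hk1 : ‖k‖ = 1)
    (hk : M.fwd k = 0) : (M.Aᵀ * M.A).rank < p := by
  have h1 := LinearMap.finrank_range_add_finrank_ker (M.Aᵀ * M.A).mulVecLin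
  have hmem : k.ofLp ∈ LinearMap.ker (M.Aᵀ * M.A).mulVecLin := by
    have hu' : M.A *ᵥ k.ofLp = 0 := by simpa [fwd, Matrix.toLpLin_apply] using hk
    simp [hu']
  have h2 : 0 < Module.finrank ℝ (LinearMap.ker (M.Aᵀ * M.A).mulVecLin) := by
    rw [Module.finrank_pos_iff]
    refine ⟨⟨k.ofLp, hmem⟩, 0, fun h0 => ?_⟩
    have : k = 0 := by simpa using h0
    simp [this] at hk1
  have : Module.finrank ℝ (Fin p → ℝ) = p := by simp
  rw [← Matrix.rank, this] at h1
  omega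

lemma PA_apply_eq_zero {u : EuclideanSpace ℝ (Fin p)} (hu : M.fwd u = 0) : M.PA u = 0 := by
  rw [PA, Submodule.starProjection_apply_eq_zero_iff, Submodule.mem_orthogonal]
  rintro _ ⟨z, rfl⟩
  rw [real_inner_comm, inner_toEuclideanLin_transpose]
  change inner ℝ (M.fwd u) z = 0
  rw [hu, inner_zero_left]

end InverseProblem

/-! ### Taylor expansion along segments and first-order conditions. -/

section Calculus

/-- Two growth comparisons: the remainder of `φ₁` against `e t`, then that of `φ` against `e t² /
2`. -/
lemma abs_sub_sub_le_of_hasDerivAt_two {φ φ₁ φ₂ : ℝ → ℝ} {b e : ℝ}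
    (h₁ : ∀ t ∈ Set.Icc (0 : ℝ) 1, HasDerivAt φ (φ₁ t) t)
    (h₂ : ∀ t ∈ Set.Icc (0 : ℝ) 1, HasDerivAt φ₁ (φ₂ t) t)
    (hb : ∀ t ∈ Set.Icc (0 : ℝ) 1, |φ₂ t - b| ≤ e) :
    |φ 1 - φ 0 - φ₁ 0 - b / 2| ≤ e / 2 := by
  have h3 : ∀ t ∈ Set.Icc (0 : ℝ) 1,
      HasDerivAt (fun t : ℝ => φ₁ t - φ₁ 0 - t * b) (φ₂ t - b) t := fun t ht =>
    (((h₂ t ht).sub_const (φ₁ 0)).sub ((hasDerivAt_id t).mul_const b)).congr_deriv (by simp)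
  have h4 : ∀ t ∈ Set.Icc (0 : ℝ) 1, ‖φ₁ t - φ₁ 0 - t * b‖ ≤ e * t := by
    refine image_norm_le_of_norm_deriv_right_le_deriv_boundary (B' := fun _ => e)
      (fun t ht => (h3 t ht).continuousAt.continuousWithinAt)
      (fun t ht => (h3 t (Set.Ico_subset_Icc_self ht)).hasDerivWithinAt) (by simp)
      (fun t => by simpa using (hasDerivAt_id t).const_mul e)
      (fun t ht => hb t (Set.Ico_subset_Icc_self ht))
  have h5 : ∀ t ∈ Set.Icc (0 : ℝ) 1,
      HasDerivAt (fun t : ℝ => φ t - φ 0 - t * φ₁ 0 - t ^ 2 * (b / 2))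
        (φ₁ t - φ₁ 0 - t * b) t := fun t ht => by
    have := (((h₁ t ht).sub_const (φ 0)).sub ((hasDerivAt_id t).mul_const (φ₁ 0))).sub
      ((hasDerivAt_pow 2 t).mul_const (b / 2))
    refine this.congr_deriv ?_
    norm_num
    ring
  have h6 := image_norm_le_of_norm_deriv_right_le_deriv_boundary (a := 0) (b := 1)
    (B := fun t => e / 2 * t ^ 2) (B' := fun t => e * t)
      (fun t ht => (h5 t ht).continuousAt.continuousWithinAt)
      (fun t ht => (h5 t (Set.Ico_subset_Icc_self ht)).hasDerivWithinAt) (by simp)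
      (fun t => ((hasDerivAt_pow 2 t).const_mul (e / 2)).congr_deriv (by norm_num; ring))
      (fun t ht => h4 t (Set.Ico_subset_Icc_self ht)) (Set.right_mem_Icc.2 zero_le_one)
  simpa using h6

/-- Second order Taylor expansion along a segment on which the second derivative is within `e`
of `b`. -/
lemma abs_taylor_two_sub_le {E : Type*} [NormedAddCommGroup E] [NormedSpace ℝ E] {F : E → ℝ}
    {x u : E} {b e : ℝ} (hF : ∀ t ∈ Set.Icc (0 : ℝ) 1, ContDiffAt ℝ 2 F (x + t • u))
    (hb : ∀ t ∈ Set.Icc (0 : ℝ) 1, |fderiv ℝ (fderiv ℝ F) (x + t • u) u u - b| ≤ e) :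
    |F (x + u) - F x - fderiv ℝ F x u - b / 2| ≤ e / 2 := by
  have hline : ∀ t : ℝ, HasDerivAt (fun t : ℝ => x + t • u) u t := fun t => by
    simpa using ((hasDerivAt_id t).smul_const u).const_add x
  have h1 : ∀ t ∈ Set.Icc (0 : ℝ) 1,
      HasDerivAt (fun t : ℝ => F (x + t • u)) (fderiv ℝ F (x + t • u) u) t := fun t ht =>
    (((hF t ht).differentiableAt (by norm_num)).hasFDerivAt).comp_hasDerivAt t (hline t)
  have h2 : ∀ t ∈ Set.Icc (0 : ℝ) 1,
      HasDerivAt (fun t : ℝ => fderiv ℝ F (x + t • u) u)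
        (fderiv ℝ (fderiv ℝ F) (x + t • u) u u) t := fun t ht => by
    have hd : DifferentiableAt ℝ (fderiv ℝ F) (x + t • u) :=
      ((hF t ht).fderiv_right (m := 1) (by norm_num)).differentiableAt (by norm_num)
    have h3 : HasDerivAt (fun t : ℝ => fderiv ℝ F (x + t • u))
        (fderiv ℝ (fderiv ℝ F) (x + t • u) u) t := hd.hasFDerivAt.comp_hasDerivAt t (hline t)
    exact (ContinuousLinearMap.apply ℝ ℝ u).hasFDerivAt.comp_hasDerivAt t h3
  simpa using abs_sub_sub_le_of_hasDerivAt_two h1 h2 hb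

lemma fderiv_fderiv_apply_eq_inner {m : ℕ} (F : EuclideanSpace ℝ (Fin m) → ℝ)
    (x u v : EuclideanSpace ℝ (Fin m)) :
    fderiv ℝ (fderiv ℝ F) x u v = inner ℝ u (Matrix.toEuclideanLin (hessianMatrix F x) v) := by
  have hsum : ∀ w : EuclideanSpace ℝ (Fin m), w = ∑ i, w i • EuclideanSpace.single i (1 : ℝ) :=
    fun w => by simpa using ((EuclideanSpace.basisFun (Fin m) ℝ).sum_repr w).symm
  conv_lhs => rw [hsum u, hsum v]
  rw [inner_toEuclideanLin_eq_dotProduct]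
  simp only [map_sum, map_smul, sum_apply, smul_apply,
    smul_eq_mul, dotProduct, Matrix.mulVec, hessianMatrix, Matrix.of_apply]
  simp only [Finset.mul_sum]
  rw [Finset.sum_comm]
  refine Finset.sum_congr rfl fun i _ => Finset.sum_congr rfl fun j _ => by ring

/-- Minimality is asked along one line only: `g` is minimal at `xs` just in the directions of `ker
A`, and the likelihood just on `A X`. -/
lemma fderiv_apply_eq_zero_of_le {E : Type*} [NormedAddCommGroup E] [NormedSpace ℝ E] {F : E → ℝ}
    {x u : E} (hF : DifferentiableAt ℝ F x) (h : ∀ᶠ t : ℝ in 𝓝 0, F x ≤ F (x + t • u)) :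
    fderiv ℝ F x u = 0 := by
  have hline : HasDerivAt (fun t : ℝ => x + t • u) u 0 := by
    simpa using ((hasDerivAt_id (0 : ℝ)).smul_const u).const_add x
  have hF' : HasFDerivAt F (fderiv ℝ F x) (x + (0 : ℝ) • u) := by simpa using hF.hasFDerivAt
  have h1 : HasDerivAt (fun t : ℝ => F (x + t • u)) (fderiv ℝ F x u) 0 :=
    hF'.comp_hasDerivAt 0 hline
  refine IsLocalMin.hasDerivAt_eq_zero ?_ h1
  filter_upwards [h] with t ht
  simpa using ht

lemma inner_gradient_eq_fderiv {E : Type*} [NormedAddCommGroup E] [InnerProductSpace ℝ E]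
    [CompleteSpace E] (F : E → ℝ) (x u : E) : inner ℝ (gradient F x) u = fderiv ℝ F x u := by
  simp [gradient]

lemma eventually_add_smul_mem_of_mem_interior {E : Type*} [NormedAddCommGroup E] [NormedSpace ℝ E]
    {s : Set E} {x : E} (hx : x ∈ interior s) (u : E) : ∀ᶠ t : ℝ in 𝓝 0, x + t • u ∈ s := by
  have hc : ContinuousAt (fun t : ℝ => x + t • u) 0 := by fun_prop
  exact hc.eventually_mem (by simpa using mem_interior_iff_mem_nhds.1 hx)

end Calculus

/-! ### Stationarity at `xs` and local expansion of `h`. -/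

namespace InverseProblem

variable {n p : ℕ} {M : InverseProblem n p} {xs : EuclideanSpace ℝ (Fin p)}

lemma IsPriorMinimiser.le {x : EuclideanSpace ℝ (Fin p)} (hxs : M.IsPriorMinimiser xs)
    (hx : x ∈ M.X) (h : M.fwd x = M.fwd xs) : M.g xs ≤ M.g x := by
  rcases eq_or_ne x xs with rfl | hne
  · exact le_rfl
  · exact (hxs.2.2 x hx (h.trans hxs.2.1) hne).le

/-- At the prior minimiser, the gradient of the prior is orthogonal to the kernel of the forward
map. -/
lemma IsPriorMinimiser.fderiv_g_eq_zero (hxs : M.IsPriorMinimiser xs) (hint : xs ∈ interior M.X)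
    (hg : DifferentiableAt ℝ M.g xs) {k : EuclideanSpace ℝ (Fin p)} (hk : M.fwd k = 0) :
    fderiv ℝ M.g xs k = 0 := by
  refine fderiv_apply_eq_zero_of_le hg ?_
  filter_upwards [eventually_add_smul_mem_of_mem_interior hint k] with t ht
  exact hxs.le ht (by rw [fwd_add, fwd_smul, hk, smul_zero, add_zero])

lemma IsPriorMinimiser.exists_gradient_eq (hxs : M.IsPriorMinimiser xs)
    (hint : xs ∈ interior M.X) (hg : DifferentiableAt ℝ M.g xs) :
    ∃ z, gradient M.g xs = Matrix.toEuclideanLin M.Aᵀ z :=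
  exists_eq_toEuclideanLin_transpose _ fun k hk => by
    rw [inner_gradient_eq_fderiv]
    exact hxs.fderiv_g_eq_zero hint hg hk

lemma ftil_yexact_le (hid : ∀ μ₀ ∈ M.fwd '' M.X, ∀ η ∈ M.fwd '' M.X, η ≠ μ₀ →
    M.ftil (M.G μ₀) μ₀ < M.ftil (M.G μ₀) η) (hxs : M.IsPriorMinimiser xs)
    {x : EuclideanSpace ℝ (Fin p)} (hx : x ∈ M.X) :
    M.ftil M.yexact (M.fwd xs) ≤ M.ftil M.yexact (M.fwd x) := by
  have hy : M.yexact = M.G (M.fwd xs) := by rw [yexact, hxs.2.1]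
  rcases eq_or_ne (M.fwd x) (M.fwd xs) with h | h
  · rw [h]
  · rw [hy]
    exact (hid _ ⟨xs, hxs.1, rfl⟩ _ ⟨x, hx, rfl⟩ h).le

lemma fderiv_ftil_yexact_eq_zero (hid : ∀ μ₀ ∈ M.fwd '' M.X, ∀ η ∈ M.fwd '' M.X, η ≠ μ₀ →
    M.ftil (M.G μ₀) μ₀ < M.ftil (M.G μ₀) η) (hxs : M.IsPriorMinimiser xs)
    (hint : xs ∈ interior M.X) (hf : DifferentiableAt ℝ (M.ftil M.yexact) (M.fwd xs))
    (u : EuclideanSpace ℝ (Fin p)) : fderiv ℝ (M.ftil M.yexact) (M.fwd xs) (M.fwd u) = 0 := by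
  refine fderiv_apply_eq_zero_of_le hf ?_
  filter_upwards [eventually_add_smul_mem_of_mem_interior hint u] with t ht
  rw [← fwd_smul, ← fwd_add]
  exact ftil_yexact_le hid hxs ht

variable {Cf M₁ S₂ : Matrix (Fin n) (Fin n) ℝ} {Cg : Matrix (Fin p) (Fin p) ℝ}

/-- Triangle inequality through `M.V y xs`: moving `x` costs `δ`, moving `y` costs `r`. -/
lemma exists_hessian_ftil_le (M : InverseProblem n p) (xs : EuclideanSpace ℝ (Fin p))
    (Cf M₁ S₂ : Matrix (Fin n) (Fin n) ℝ) (Cg : Matrix (Fin p) (Fin p) ℝ) :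
    ∃ C > 0, ∀ r δ, 0 ≤ r → 0 < δ →
      M.SmoothNear xs Cf Cg r δ → M.ConvergesInY xs M₁ S₂ r → ∀ y ∈ M.Yloc r,
      ∀ x ∈ Metric.closedBall xs δ, ∀ v,
      |fderiv ℝ (fderiv ℝ (M.ftil y)) (M.fwd x) v v
        - inner ℝ v (Matrix.toEuclideanLin (M.V M.yexact xs) v)| ≤ C * (δ + r) * ‖v‖ ^ 2 := by
  set s := matrixSpectralNorm S₂
  have hs : 0 ≤ s := matrixSpectralNorm_nonneg _
  have ha := matrixSpectralNorm_nonneg M.A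
  have hc := matrixSpectralNorm_nonneg Cf
  refine ⟨matrixSpectralNorm M.A * matrixSpectralNorm Cf + s ^ 2 + 1, by positivity,
    fun r δ hr hδ hsm hcv y hy x hx v => ?_⟩
  rw [fderiv_fderiv_apply_eq_inner]
  have h1 := hsm.hessian_ftil y hy x hx v.ofLp
  rw [← inner_toEuclideanLin_eq_dotProduct, ← inner_toEuclideanLin_eq_dotProduct, map_sub,
    LinearMap.sub_apply, inner_sub_right] at h1
  have h2 := hcv.hessian_ftil y hy v.ofLp
  rw [← inner_toEuclideanLin_eq_dotProduct, ← inner_toEuclideanLin_eq_dotProduct, map_sub,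
    LinearMap.sub_apply, inner_sub_right, toEuclideanLin_mul_apply, toEuclideanLin_mul_apply] at h2
  have h3 : inner ℝ v (Matrix.toEuclideanLin Cf v) ≤ matrixSpectralNorm Cf * ‖v‖ ^ 2 := by
    rw [pow_two]
    exact (le_abs_self _).trans (abs_inner_toEuclideanLin_le Cf v v)
  have hdiag : ∀ w : EuclideanSpace ℝ (Fin n), ‖Matrix.toEuclideanLin
      (Matrix.diagonal (fun j => |y j - M.yexact j|)) w‖ ≤ r * ‖w‖ := by
    intro w
    rw [← Real.sqrt_sq (mul_nonneg hr (norm_nonneg w)), EuclideanSpace.norm_eq]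
    refine Real.sqrt_le_sqrt ?_
    rw [mul_pow, EuclideanSpace.norm_sq_eq, Finset.mul_sum]
    refine Finset.sum_le_sum fun j _ => ?_
    have hj : |y j - M.yexact j| ≤ r := by
      have := PiLp.norm_apply_le (y - M.yexact) j
      exact (by simpa using this : |y j - M.yexact j| ≤ _).trans hy.2
    simp only [Matrix.toLpLin_apply, Matrix.mulVec_diagonal, norm_mul, Real.norm_eq_abs, abs_abs,
      mul_pow]
    gcongr
  have h4 : inner ℝ v (Matrix.toEuclideanLin S₂ (Matrix.toEuclideanLin
      (Matrix.diagonal (fun j => |y j - M.yexact j|)) (Matrix.toEuclideanLin S₂ v)))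
      ≤ s ^ 2 * r * ‖v‖ ^ 2 :=
    calc _ ≤ ‖v‖ * (s * (r * (s * ‖v‖))) := by
          refine (real_inner_le_norm _ _).trans ?_
          gcongr
          refine (norm_toEuclideanLin_le _ _).trans ?_
          gcongr
          refine (hdiag _).trans ?_
          gcongr
          exact norm_toEuclideanLin_le _ _
      _ = _ := by ring
  have h5 : δ * matrixSpectralNorm M.A * inner ℝ v (Matrix.toEuclideanLin Cf v)
      ≤ δ * matrixSpectralNorm M.A * (matrixSpectralNorm Cf * ‖v‖ ^ 2) := by gcongr
  change |inner ℝ v (Matrix.toEuclideanLin (M.V y x) v) - _| ≤ _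
  refine (abs_sub_le _ (inner ℝ v (Matrix.toEuclideanLin (M.V y xs) v)) _).trans ?_
  have h6 : 0 ≤ ‖v‖ ^ 2 := by positivity
  have h7 : 0 ≤ matrixSpectralNorm M.A * matrixSpectralNorm Cf * r * ‖v‖ ^ 2 := by positivity
  have h8 : 0 ≤ s ^ 2 * δ * ‖v‖ ^ 2 := by positivity
  have h9 : 0 ≤ (δ + r) * ‖v‖ ^ 2 := by positivity
  linarith

lemma SmoothNear.hessian_g_le {r δ : ℝ} (hδ : 0 < δ) (hsm : M.SmoothNear xs Cf Cg r δ)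
    {x : EuclideanSpace ℝ (Fin p)} (hx : x ∈ Metric.closedBall xs δ)
    (u : EuclideanSpace ℝ (Fin p)) :
    |fderiv ℝ (fderiv ℝ M.g) x u u - inner ℝ u (Matrix.toEuclideanLin (hessianMatrix M.g xs) u)|
      ≤ matrixSpectralNorm Cg * δ * ‖u‖ ^ 2 := by
  rw [fderiv_fderiv_apply_eq_inner]
  have h1 := hsm.hessian_g x hx u.ofLp
  rw [← inner_toEuclideanLin_eq_dotProduct, ← inner_toEuclideanLin_eq_dotProduct, map_sub,
    LinearMap.sub_apply, inner_sub_right] at h1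
  have h3 : inner ℝ u (Matrix.toEuclideanLin Cg u) ≤ matrixSpectralNorm Cg * ‖u‖ ^ 2 := by
    rw [pow_two]
    exact (le_abs_self _).trans (abs_inner_toEuclideanLin_le Cg u u)
  nlinarith

lemma add_smul_mem_closedBall {δ t : ℝ} {x u : EuclideanSpace ℝ (Fin p)}
    (hx : x ∈ Metric.closedBall xs δ) (hxu : x + u ∈ Metric.closedBall xs δ)
    (ht : t ∈ Set.Icc (0 : ℝ) 1) : x + t • u ∈ Metric.closedBall xs δ :=
  (convex_closedBall xs δ).add_smul_mem hx hxu ht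

lemma SmoothNear.abs_taylor_g_sub_le {r δ : ℝ} (hδ : 0 < δ) (hsm : M.SmoothNear xs Cf Cg r δ)
    {x u : EuclideanSpace ℝ (Fin p)} (hx : x ∈ Metric.closedBall xs δ)
    (hxu : x + u ∈ Metric.closedBall xs δ) :
    |M.g (x + u) - M.g x - fderiv ℝ M.g x u
      - inner ℝ u (Matrix.toEuclideanLin (hessianMatrix M.g xs) u) / 2|
      ≤ matrixSpectralNorm Cg * δ * ‖u‖ ^ 2 / 2 :=
  abs_taylor_two_sub_le (fun _ ht => hsm.contDiffAt_g _ (add_smul_mem_closedBall hx hxu ht))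
    (fun _ ht => hsm.hessian_g_le hδ (add_smul_mem_closedBall hx hxu ht) u)

/-- Uniform second order expansion of the scaled negative log posterior density near `xs`. -/
lemma exists_abs_taylor_h_sub_le (M : InverseProblem n p) (xs : EuclideanSpace ℝ (Fin p))
    (Cf M₁ S₂ : Matrix (Fin n) (Fin n) ℝ) (Cg : Matrix (Fin p) (Fin p) ℝ)
    (hV : (M.V M.yexact xs).PosDef) {ν₀ : ℝ} (hν₀ : 0 < ν₀) (hH : (M.Hnu xs ν₀).PosDef) :
    ∃ ε > 0, ∀ r δ ν, 0 ≤ r → 0 < δ → δ + r ≤ ε → 0 < ν → ν ≤ ν₀ / 2 →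
      M.SmoothNear xs Cf Cg r δ → M.ConvergesInY xs M₁ S₂ r → ∀ y ∈ M.Yloc r,
      ∀ x u, x ∈ Metric.closedBall xs δ → x + u ∈ Metric.closedBall xs δ →
      |M.h ν y (x + u) - M.h ν y x - (fderiv ℝ (M.ftil y) (M.fwd x) (M.fwd u)
          + ν * fderiv ℝ M.g x u) - inner ℝ u (Matrix.toEuclideanLin (M.Hnu xs ν) u) / 2|
        ≤ inner ℝ u (Matrix.toEuclideanLin (M.Hnu xs ν) u) / 4 := by
  obtain ⟨c, hc, hlow⟩ := M.exists_le_inner_Hnu hV hν₀ hH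
  obtain ⟨K, hK, hf⟩ := M.exists_hessian_ftil_le xs Cf M₁ S₂ Cg
  set K' := K + matrixSpectralNorm Cg with hK'
  have hCg := matrixSpectralNorm_nonneg Cg
  have hK'pos : 0 < K' := by positivity
  -- With this `ε` the Taylor remainder is at most `c (‖A u‖² + ν ‖u‖²) / 4`, hence a quarter of the
  -- form of `H_ν`. The prior error carries its own factor `ν`, so `ε` is independent of `ν`.
  refine ⟨c / (2 * K'), by positivity,
    fun r δ ν hr hδ hsmall hν hνle hsm hcv y hy x u hx hxu => ?_⟩
  have h1 : |M.ftil y (M.fwd x + M.fwd u) - M.ftil y (M.fwd x)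
      - fderiv ℝ (M.ftil y) (M.fwd x) (M.fwd u)
      - inner ℝ (M.fwd u) (Matrix.toEuclideanLin (M.V M.yexact xs) (M.fwd u)) / 2|
      ≤ K * (δ + r) * ‖M.fwd u‖ ^ 2 / 2 := by
    refine abs_taylor_two_sub_le (fun t ht => ?_) (fun t ht => ?_)
    · rw [← fwd_smul, ← fwd_add]
      exact hsm.contDiffAt_ftil y hy _ (add_smul_mem_closedBall hx hxu ht)
    · rw [← fwd_smul, ← fwd_add]
      exact hf r δ hr hδ hsm hcv y hy _ (add_smul_mem_closedBall hx hxu ht) _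
  have h2 := hsm.abs_taylor_g_sub_le hδ hx hxu
  have h3 := hlow ν hν hνle u
  rw [inner_Hnu] at h3 ⊢
  simp only [h, fwd_add]
  have h4 : K * (δ + r) * ‖M.fwd u‖ ^ 2 / 2 + ν * (matrixSpectralNorm Cg * δ * ‖u‖ ^ 2 / 2)
      ≤ c * (‖M.fwd u‖ ^ 2 + ν * ‖u‖ ^ 2) / 4 := by
    have e1 : K' * (δ + r) ≤ c / 2 := by
      calc K' * (δ + r) ≤ K' * (c / (2 * K')) := by gcongr
        _ = c / 2 := by field_simp
    have e2 : K * (δ + r) ≤ K' * (δ + r) := by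
      gcongr
      linarith
    have e3 : matrixSpectralNorm Cg * δ ≤ K' * (δ + r) := by
      gcongr
      · linarith
      · linarith
    have e4 : K * (δ + r) * ‖M.fwd u‖ ^ 2 ≤ c / 2 * ‖M.fwd u‖ ^ 2 := by
      gcongr
      linarith
    have e5 : ν * (matrixSpectralNorm Cg * δ * ‖u‖ ^ 2) ≤ ν * (c / 2 * ‖u‖ ^ 2) := by
      gcongr
      linarith
    linarith
  have h5 : |ν * (M.g (x + u) - M.g x - fderiv ℝ M.g x u
      - inner ℝ u (Matrix.toEuclideanLin (hessianMatrix M.g xs) u) / 2)|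
      ≤ ν * (matrixSpectralNorm Cg * δ * ‖u‖ ^ 2 / 2) := by
    rw [abs_mul, abs_of_pos hν]
    gcongr
  rw [abs_le] at h1 h5 ⊢
  constructor <;> linarith [h1.1, h1.2, h5.1, h5.2]

end InverseProblem

/-! ### Location of the posterior mode. -/

namespace InverseProblem

variable {n p : ℕ} {M : InverseProblem n p} {xs : EuclideanSpace ℝ (Fin p)}
variable {Cf M₁ S₂ : Matrix (Fin n) (Fin n) ℝ} {Cg : Matrix (Fin p) (Fin p) ℝ}

lemma yexact_mem_Yloc (hY : M.yexact ∈ M.Y) {r : ℝ} (hr : 0 ≤ r) : M.yexact ∈ M.Yloc r :=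
  ⟨hY, by simpa using hr⟩

lemma SmoothNear.hasFDerivAt_h {r δ ν : ℝ} (hsm : M.SmoothNear xs Cf Cg r δ)
    {y : EuclideanSpace ℝ (Fin n)} (hy : y ∈ M.Yloc r) {x : EuclideanSpace ℝ (Fin p)}
    (hx : x ∈ Metric.closedBall xs δ) :
    HasFDerivAt (M.h ν y) ((fderiv ℝ (M.ftil y) (M.fwd x)).comp
      (LinearMap.toContinuousLinearMap (Matrix.toEuclideanLin M.A)) + ν • fderiv ℝ M.g x) x := by
  have h1 : HasFDerivAt M.fwd (LinearMap.toContinuousLinearMap (Matrix.toEuclideanLin M.A)) x :=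
    (LinearMap.toContinuousLinearMap (Matrix.toEuclideanLin M.A)).hasFDerivAt
  have h2 := ((hsm.contDiffAt_ftil y hy x hx).differentiableAt (by norm_num)).hasFDerivAt
  have h3 := ((hsm.contDiffAt_g x hx).differentiableAt (by norm_num)).hasFDerivAt
  exact (h2.comp x h1).add (h3.const_mul ν)

/-- The gradient of the scaled negative log posterior density at `xs` is small, and vanishes on the
kernel of the forward map. -/
lemma exists_abs_fderiv_h_le (M : InverseProblem n p) (xs : EuclideanSpace ℝ (Fin p))
    (Cf M₁ S₂ : Matrix (Fin n) (Fin n) ℝ) (Cg : Matrix (Fin p) (Fin p) ℝ)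
    (hY : M.yexact ∈ M.Y)
    (hid : ∀ μ₀ ∈ M.fwd '' M.X, ∀ η ∈ M.fwd '' M.X, η ≠ μ₀ →
      M.ftil (M.G μ₀) μ₀ < M.ftil (M.G μ₀) η) (hxs : M.IsPriorMinimiser xs)
    (hint : xs ∈ interior M.X) :
    ∃ C > 0, ∀ r δ ν, 0 ≤ r → 0 < δ → 0 < ν → M.SmoothNear xs Cf Cg r δ →
      M.ConvergesInY xs M₁ S₂ r → ∀ y ∈ M.Yloc r, ∀ m k, M.fwd k = 0 →
      |fderiv ℝ (M.ftil y) (M.fwd xs) (M.fwd (m + k)) + ν * fderiv ℝ M.g xs (m + k)|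
        ≤ C * (r + ν) * ‖m‖ := by
  have ha := matrixSpectralNorm_nonneg (M.Aᵀ * M₁)
  refine ⟨matrixSpectralNorm (M.Aᵀ * M₁) + ‖fderiv ℝ M.g xs‖ + 1, by positivity,
    fun r δ ν hr hδ hν hsm hcv y hy m k hk => ?_⟩
  have hmem : xs ∈ Metric.closedBall xs δ := Metric.mem_closedBall_self hδ.le
  rw [fwd_add, hk, add_zero, map_add,
    hxs.fderiv_g_eq_zero hint ((hsm.contDiffAt_g xs hmem).differentiableAt (by norm_num)) hk,
    add_zero]
  have h0 := fderiv_ftil_yexact_eq_zero hid hxs hint ((hsm.contDiffAt_ftil _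
    (yexact_mem_Yloc hY hr) xs hmem).differentiableAt (by norm_num)) m
  -- The exact likelihood is stationary along the range of `A`, so only the difference of gradients
  -- remains.
  have h1 : fderiv ℝ (M.ftil y) (M.fwd xs) (M.fwd m) = inner ℝ m (Matrix.toEuclideanLin M.Aᵀ
      (gradient (M.ftil y) (M.fwd xs) - gradient (M.ftil M.yexact) (M.fwd xs))) := by
    rw [inner_toEuclideanLin_transpose, real_inner_comm, inner_sub_left, inner_gradient_eq_fderiv,
      inner_gradient_eq_fderiv]
    change _ = _ - fderiv ℝ (M.ftil M.yexact) (M.fwd xs) (M.fwd m)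
    rw [h0, sub_zero]
    rfl
  have h2 : |fderiv ℝ (M.ftil y) (M.fwd xs) (M.fwd m)|
      ≤ ‖m‖ * (matrixSpectralNorm (M.Aᵀ * M₁) * r) := by
    rw [h1]
    refine (abs_real_inner_le_norm _ _).trans ?_
    gcongr
    refine (hcv.gradient_ftil y hy M.Aᵀ).trans ((norm_toEuclideanLin_le _ _).trans ?_)
    gcongr
    exact hy.2
  have h3 : |ν * fderiv ℝ M.g xs m| ≤ ν * (‖fderiv ℝ M.g xs‖ * ‖m‖) := by
    rw [abs_mul, abs_of_pos hν]
    gcongr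
    exact (fderiv ℝ M.g xs).le_opNorm m
  refine (abs_add_le _ _).trans ?_
  have e1 : 0 ≤ matrixSpectralNorm (M.Aᵀ * M₁) * ν * ‖m‖ := by positivity
  have e2 : 0 ≤ ‖fderiv ℝ M.g xs‖ * r * ‖m‖ := by positivity
  have e3 : 0 ≤ (r + ν) * ‖m‖ := by positivity
  linarith

lemma le_of_mul_sq_le {b c d x y : ℝ} (hb : 0 < b) (hc : 0 ≤ c) (hd : 0 ≤ d) (hx : 0 ≤ x)
    (hy : 0 ≤ y) (h : b * x ^ 2 ≤ c * (x * y) + d * y ^ 2) : x ≤ (c / b + d / b + 1) * y := by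
  rcases le_total x y with hxy | hxy
  · have : 0 ≤ (c / b + d / b) * y := by positivity
    linarith
  · have h1 : b * (x * x) ≤ (c + d) * y * x := by nlinarith [mul_le_mul_of_nonneg_left hxy (mul_nonneg hd hy)]
    have h2 : b * x ≤ (c + d) * y := by
      rcases hx.eq_or_lt with h0 | h0
      · rw [← h0]
        simp
        positivity
      · nlinarith
    have h3 : x ≤ (c + d) * y / b := by
      rw [le_div_iff₀ hb]
      linarith
    have h4 : (c + d) * y / b = (c / b + d / b) * y := by ring
    linarith

/-- A minimiser of the prior along a coset of the kernel of the forward map is not farther from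
`xs` than a multiple of the distance of the coset from `xs`. -/
lemma exists_norm_le_of_g_le (M : InverseProblem n p) (xs : EuclideanSpace ℝ (Fin p))
    (Cf : Matrix (Fin n) (Fin n) ℝ) (Cg : Matrix (Fin p) (Fin p) ℝ)
    (hxs : M.IsPriorMinimiser xs) (hint : xs ∈ interior M.X)
    {ν₀ : ℝ} (hν₀ : 0 < ν₀) (hH : (M.Hnu xs ν₀).PosDef) :
    ∃ ε > 0, ∃ C > 0, ∀ r δ, 0 < δ → δ ≤ ε → M.SmoothNear xs Cf Cg r δ → ∀ m k, M.fwd k = 0 →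
      xs + m ∈ Metric.closedBall xs δ → xs + (m + k) ∈ Metric.closedBall xs δ →
      M.g (xs + (m + k)) ≤ M.g (xs + m) → ‖k‖ ≤ C * ‖m‖ := by
  obtain ⟨b, hb, hker⟩ := M.exists_le_inner_hessian_of_fwd_eq_zero hν₀ hH
  set B := matrixSpectralNorm (hessianMatrix M.g xs)
  have hB : 0 ≤ B := matrixSpectralNorm_nonneg _
  have hCg := matrixSpectralNorm_nonneg Cg
  refine ⟨b / (4 * (matrixSpectralNorm Cg + 1)), by positivity, 2 * B / (b / 2) + b / (b / 2) + 1,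
    by positivity, fun r δ hδ hδε hsm m k hk hm hmk hle => ?_⟩
  have hmem : xs ∈ Metric.closedBall xs δ := Metric.mem_closedBall_self hδ.le
  have h1 := abs_le.1 (hsm.abs_taylor_g_sub_le hδ hmem hm)
  have h2 := abs_le.1 (hsm.abs_taylor_g_sub_le hδ hmem hmk)
  have h3 : matrixSpectralNorm Cg * δ ≤ b / 4 :=
    calc _ ≤ (matrixSpectralNorm Cg + 1) * (b / (4 * (matrixSpectralNorm Cg + 1))) := by
          gcongr
          linarith
      _ = b / 4 := by field_simp
  have h0 := hxs.fderiv_g_eq_zero hint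
    ((hsm.contDiffAt_g xs hmem).differentiableAt (by norm_num)) hk
  rw [map_add, map_add, h0, inner_add_left, inner_add_right, inner_add_right] at h2
  have h4 := abs_le.1 (abs_inner_toEuclideanLin_le (hessianMatrix M.g xs) m k)
  have h5 := abs_le.1 (abs_inner_toEuclideanLin_le (hessianMatrix M.g xs) k m)
  have h6 := hker k hk
  have h7 : ‖m + k‖ ^ 2 ≤ 2 * ‖m‖ ^ 2 + 2 * ‖k‖ ^ 2 := by
    have := norm_add_le m k
    nlinarith [sq_nonneg (‖m‖ - ‖k‖), norm_nonneg (m + k)]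
  have h8 : matrixSpectralNorm Cg * δ * ‖m + k‖ ^ 2
      ≤ b / 4 * (2 * ‖m‖ ^ 2 + 2 * ‖k‖ ^ 2) := by gcongr
  have h9 : matrixSpectralNorm Cg * δ * ‖m‖ ^ 2 ≤ b / 4 * ‖m‖ ^ 2 := by gcongr
  -- Subtracting the expansions at `m` and `m + k`, where the linear term in `k` vanishes, gives
  -- `(b/2) ‖k‖² ≤ 2B ‖k‖ ‖m‖ + b ‖m‖²`.
  refine le_of_mul_sq_le (by positivity) (by positivity) hb.le (norm_nonneg k) (norm_nonneg m) ?_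
  have e1 : 0 ≤ b * ‖m‖ ^ 2 := by positivity
  linarith [h1.2, h2.1, h4.1, h5.1, mul_comm ‖m‖ ‖k‖]

/-- Existence, location and second order behaviour of the posterior mode. -/
lemma exists_mode (M : InverseProblem n p) (xs : EuclideanSpace ℝ (Fin p))
    (Cf M₁ S₂ : Matrix (Fin n) (Fin n) ℝ) (Cg : Matrix (Fin p) (Fin p) ℝ)
    (hY : M.yexact ∈ M.Y)
    (hid : ∀ μ₀ ∈ M.fwd '' M.X, ∀ η ∈ M.fwd '' M.X, η ≠ μ₀ →
      M.ftil (M.G μ₀) μ₀ < M.ftil (M.G μ₀) η) (hxs : M.IsPriorMinimiser xs)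
    (hint : xs ∈ interior M.X) (hV : (M.V M.yexact xs).PosDef) {ν₀ : ℝ} (hν₀ : 0 < ν₀)
    (hH : (M.Hnu xs ν₀).PosDef) :
    ∃ ε > 0, ∃ C > 0, ∀ r δ ν, 0 ≤ r → 0 < δ → δ + r ≤ ε → 0 < ν → ν ≤ ν₀ / 2 →
      C * (r + ν) < δ →
      M.SmoothNear xs Cf Cg r δ → M.ConvergesInY xs M₁ S₂ r → ∀ y ∈ M.Yloc r,
      ∃ x₀, ‖x₀ - xs‖ ≤ C * (r + ν) ∧ ∀ u, x₀ + u ∈ Metric.closedBall xs δ →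
        inner ℝ u (Matrix.toEuclideanLin (M.Hnu xs ν) u) / 4 ≤ M.h ν y (x₀ + u) - M.h ν y x₀ ∧
        M.h ν y (x₀ + u) - M.h ν y x₀
          ≤ 3 / 4 * inner ℝ u (Matrix.toEuclideanLin (M.Hnu xs ν) u) := by
  obtain ⟨ε₁, hε₁, htay⟩ := M.exists_abs_taylor_h_sub_le xs Cf M₁ S₂ Cg hV hν₀ hH
  obtain ⟨C₁, hC₁, hgrad⟩ := M.exists_abs_fderiv_h_le xs Cf M₁ S₂ Cg hY hid hxs hint
  obtain ⟨ε₂, hε₂, C₂, hC₂, hk⟩ := M.exists_norm_le_of_g_le xs Cf Cg hxs hint hν₀ hH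
  obtain ⟨c, hc, hlow⟩ := M.exists_le_inner_Hnu hV hν₀ hH
  obtain ⟨D, hD, hdec⟩ := M.exists_add_ker_norm_le
  refine ⟨min ε₁ ε₂, by positivity, (1 + C₂) * (D * (D * C₁ * 4 / c)), by positivity,
    fun r δ ν hr hδ hsmall hν hνle hbias hsm hcv y hy => ?_⟩
  have hsmall₁ : δ + r ≤ ε₁ := hsmall.trans (min_le_left _ _)
  have hsmall₂ : δ ≤ ε₂ := by linarith [min_le_right ε₁ ε₂]
  have hmem : xs ∈ Metric.closedBall xs δ := Metric.mem_closedBall_self hδ.le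
  have hcont : ContinuousOn (M.h ν y) (Metric.closedBall xs δ) := fun x hx =>
    (hsm.hasFDerivAt_h hy hx).continuousAt.continuousWithinAt
  obtain ⟨x₀, hx₀, hmin⟩ := (isCompact_closedBall xs δ).exists_isMinOn ⟨xs, hmem⟩ hcont
  have hmin' : ∀ x ∈ Metric.closedBall xs δ, M.h ν y x₀ ≤ M.h ν y x := fun x hx => hmin hx
  obtain ⟨m, k, hmk, hk0, hm, hm'⟩ := hdec (x₀ - xs)
  have hx₀' : xs + (m + k) = x₀ := by rw [← hmk]; abel
  have hxm : xs + m ∈ Metric.closedBall xs δ := by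
    rw [Metric.mem_closedBall, dist_eq_norm] at hx₀ ⊢
    simpa using hm'.trans hx₀
  have hfwd : M.fwd (x₀ - xs) = M.fwd m := by rw [hmk, fwd_add, hk0, add_zero]
  -- `x₀` and `xs + m` have the same image under `A`, so minimality of `h` at `x₀` reduces to a
  -- comparison of `g` after dividing by `ν`.
  have hkm : ‖k‖ ≤ C₂ * ‖m‖ := by
    refine hk r δ hδ hsmall₂ hsm m k hk0 hxm (by rwa [hx₀']) ?_
    have := hmin' _ hxm
    rw [hx₀']
    simp only [h] at this
    have e1 : M.fwd x₀ = M.fwd (xs + m) := by rw [← hx₀', ← add_assoc, fwd_add, hk0, add_zero]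
    rw [e1] at this
    have : ν * M.g x₀ ≤ ν * M.g (xs + m) := by linarith
    exact le_of_mul_le_mul_left this hν
  -- From `h(x₀) ≤ h(xs)` a quarter of the quadratic form is at most the linear term, and `‖m‖ ≤ D
  -- ‖A m‖` lets one factor `‖A m‖` cancel.
  have hAm : ‖M.fwd m‖ ≤ D * C₁ * 4 / c * (r + ν) := by
    have h1 := abs_le.1 (htay r δ ν hr hδ hsmall₁ hν hνle hsm hcv y hy xs (m + k) hmem
      (by rwa [hx₀']))
    have h2 := hgrad r δ ν hr hδ hν hsm hcv y hy m k hk0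
    have h3 := hlow ν hν hνle (m + k)
    have h4 := hmin' xs hmem
    rw [hx₀'] at h1
    rw [fwd_add, hk0, add_zero] at h3
    have h5 : c * ‖M.fwd m‖ ^ 2 ≤ 4 * (C₁ * (r + ν) * ‖m‖) := by
      have : 0 ≤ c * (ν * ‖m + k‖ ^ 2) := by positivity
      have := (abs_le.1 h2).1
      linarith [h1.1]
    rw [hfwd] at hm
    have h6 : 4 * (C₁ * (r + ν) * ‖m‖) ≤ 4 * (C₁ * (r + ν) * (D * ‖M.fwd m‖)) := by gcongr
    rw [div_mul_eq_mul_div, le_div_iff₀ hc]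
    rcases (norm_nonneg (M.fwd m)).eq_or_lt with h0 | h0
    · rw [← h0, zero_mul]
      positivity
    · nlinarith
  have hloc : ‖x₀ - xs‖ ≤ (1 + C₂) * (D * (D * C₁ * 4 / c)) * (r + ν) :=
    calc ‖x₀ - xs‖ ≤ ‖m‖ + ‖k‖ := by rw [hmk]; exact norm_add_le _ _
      _ ≤ (1 + C₂) * ‖m‖ := by linarith
      _ ≤ (1 + C₂) * (D * (D * C₁ * 4 / c * (r + ν))) := by
        gcongr
        rw [hfwd] at hm
        exact hm.trans (by gcongr)
      _ = _ := by ring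
  refine ⟨x₀, hloc, fun u hu => ?_⟩
  -- The strict bias condition puts `x₀` in the open ball, so the derivative vanishes there and the
  -- expansion about `x₀` has no linear term.
  have hball : x₀ ∈ Metric.ball xs δ := by
    rw [Metric.mem_ball, dist_eq_norm]
    exact hloc.trans_lt hbias
  have hlm : IsLocalMin (M.h ν y) x₀ := by
    filter_upwards [Metric.isOpen_ball.mem_nhds hball] with x hx
    exact hmin' x (Metric.ball_subset_closedBall hx)
  have hzero := congrArg (fun L => L u) (hlm.hasFDerivAt_eq_zero (hsm.hasFDerivAt_h hy hx₀))
  have h1 := abs_le.1 (htay r δ ν hr hδ hsmall₁ hν hνle hsm hcv y hy x₀ u hx₀ hu)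
  have hzero' : fderiv ℝ (M.ftil y) (M.fwd x₀) (M.fwd u) + ν * fderiv ℝ M.g x₀ u = 0 := by
    simpa [fwd] using hzero
  rw [hzero'] at h1
  constructor <;> linarith [h1.1, h1.2]

end InverseProblem

/-! ### Prokhorov distance to a point mass, and the Ky Fan distance. -/

section Probability

/-- If `x` is outside the `ε`-thickening of `B`, then `B` lies in the tail; if `x ∈ B`, the
thickening contains the open ball. One tail bound therefore serves both inequalities of the metric.
-/
lemma levyProkhorovDist_dirac_le {E : Type*} [PseudoMetricSpace E] [MeasurableSpace E]
    [OpensMeasurableSpace E] (μ : Measure E) [IsProbabilityMeasure μ] {x : E} {ε : ℝ} (hε : 0 ≤ ε)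
    (h : μ {z | ε ≤ dist z x} ≤ ENNReal.ofReal ε) :
    levyProkhorovDist μ (Measure.dirac x) ≤ ε := by
  refine ENNReal.toReal_le_of_le_ofReal hε (sInf_le fun B hB => ?_)
  rw [ENNReal.toReal_ofReal hε]
  have hmeas : MeasurableSet {z | ε ≤ dist z x} :=
    (isClosed_le continuous_const (continuous_id.dist continuous_const)).measurableSet
  constructor
  · by_cases hx : x ∈ Metric.thickening ε B
    · rw [Measure.dirac_apply' _ Metric.isOpen_thickening.measurableSet,
        Set.indicator_of_mem hx]
      exact prob_le_one.trans le_self_add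
    · refine (measure_mono fun z hz => ?_).trans (h.trans le_add_self)
      rw [Set.mem_ofPred_eq]
      by_contra! hlt
      exact hx (Metric.mem_thickening_iff.2 ⟨z, hz, by rwa [dist_comm]⟩)
  · by_cases hx : x ∈ B
    · rw [Measure.dirac_apply' _ hB, Set.indicator_of_mem hx]
      have h1 : {z | ε ≤ dist z x}ᶜ ⊆ Metric.thickening ε B := fun z hz =>
        Metric.mem_thickening_iff.2 ⟨x, hx, by simpa using hz⟩
      calc (1 : ℝ≥0∞) = μ {z | ε ≤ dist z x}ᶜ + μ {z | ε ≤ dist z x} := by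
            rw [add_comm, measure_add_measure_compl hmeas, measure_univ]
        _ ≤ _ := add_le_add (measure_mono h1) h
    · rw [Measure.dirac_apply' _ hB, Set.indicator_of_notMem hx]
      exact zero_le

variable {Ω W : Type*} [MeasurableSpace Ω] {P : Measure Ω} {d : W → W → ℝ} {ξ₁ ξ₂ : Ω → W}

lemma kyFanDist_nonneg : 0 ≤ kyFanDist P d ξ₁ ξ₂ := Real.sInf_nonneg fun _ h => h.1.le

lemma kyFanDist_le {ε : ℝ} (hε : 0 < ε)
    (h : P {ω | ε < d (ξ₁ ω) (ξ₂ ω)} < ENNReal.ofReal ε) : kyFanDist P d ξ₁ ξ₂ ≤ ε :=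
  csInf_le ⟨0, fun _ h => h.1.le⟩ ⟨hε, h⟩

/-- The infimum need not belong to the defining set, so the bound is reached by continuity from
below along `κ + 1 / (k + 1)`. -/
lemma measure_kyFanDist_lt_le [IsProbabilityMeasure P] :
    P {ω | kyFanDist P d ξ₁ ξ₂ < d (ξ₁ ω) (ξ₂ ω)} ≤ ENNReal.ofReal (kyFanDist P d ξ₁ ξ₂) := by
  set S := {ε : ℝ | 0 < ε ∧ P {ω | ε < d (ξ₁ ω) (ξ₂ ω)} < ENNReal.ofReal ε} with hS
  have hne : S.Nonempty := ⟨2, two_pos, prob_le_one.trans_lt (by norm_num)⟩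
  set κ := kyFanDist P d ξ₁ ξ₂ with hκ
  have hup : ∀ ε > κ, P {ω | ε < d (ξ₁ ω) (ξ₂ ω)} ≤ ENNReal.ofReal ε := by
    intro ε hε
    obtain ⟨s, hs, hsε⟩ := exists_lt_of_csInf_lt hne hε
    refine (measure_mono fun ω hω => ?_).trans (hs.2.le.trans (ENNReal.ofReal_le_ofReal hsε.le))
    exact hsε.trans hω
  have hunion : {ω | κ < d (ξ₁ ω) (ξ₂ ω)} = ⋃ k : ℕ, {ω | κ + 1 / ((k : ℝ) + 1) < d (ξ₁ ω) (ξ₂ ω)} := by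
    ext ω
    simp only [Set.mem_ofPred_eq, Set.mem_iUnion]
    constructor
    · intro h
      obtain ⟨k, hk⟩ := exists_nat_one_div_lt (sub_pos.2 h)
      exact ⟨k, by linarith⟩
    · rintro ⟨k, hk⟩
      have : (0 : ℝ) < 1 / ((k : ℝ) + 1) := by positivity
      linarith
  have hmono : Monotone fun k : ℕ => {ω | κ + 1 / ((k : ℝ) + 1) < d (ξ₁ ω) (ξ₂ ω)} := by
    intro k l hkl ω hω
    simp only [Set.mem_ofPred_eq] at hω ⊢
    have : 1 / ((l : ℝ) + 1) ≤ 1 / ((k : ℝ) + 1) := by gcongr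
    linarith
  rw [hunion]
  refine le_of_tendsto_of_tendsto (tendsto_measure_iUnion_atTop hmono)
    (ENNReal.tendsto_ofReal (?_ : Tendsto (fun k : ℕ => κ + 1 / ((k : ℝ) + 1)) atTop (𝓝 κ))) ?_
  · simpa using tendsto_one_div_add_atTop_nhds_zero_nat.const_add κ
  · refine Eventually.of_forall fun k => hup _ ?_
    have : (0 : ℝ) < 1 / ((k : ℝ) + 1) := by positivity
    linarith

end Probability

/-! ### Comparison with Gaussian integrals. -/

section GaussianTails

variable {p : ℕ} {H : Matrix (Fin p) (Fin p) ℝ} {θ : ℝ}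

lemma continuous_inner_toEuclideanLin (H : Matrix (Fin p) (Fin p) ℝ) :
    Continuous fun u : EuclideanSpace ℝ (Fin p) => inner ℝ u (Matrix.toEuclideanLin H u) :=
  continuous_id.inner (LinearMap.continuous_of_finiteDimensional _)

lemma integrable_exp_neg_quadratic (hθ : 0 < θ)
    (hH : ∀ u, θ * ‖u‖ ^ 2 ≤ inner ℝ u (Matrix.toEuclideanLin H u)) {c : ℝ} (hc : 0 < c) :
    Integrable fun u : EuclideanSpace ℝ (Fin p) =>
      Real.exp (-(c * inner ℝ u (Matrix.toEuclideanLin H u))) := by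
  have h1 : Integrable fun u : EuclideanSpace ℝ (Fin p) => Real.exp (-(c * θ) * ‖u‖ ^ 2) := by
    have := GaussianFourier.integrable_cexp_neg_mul_sq_norm_add (b := ((c * θ : ℝ) : ℂ))
      (V := EuclideanSpace ℝ (Fin p)) (by rw [Complex.ofReal_re]; positivity) 0 0
    refine this.norm.congr (Eventually.of_forall fun u => ?_)
    simp only [Complex.norm_exp]
    congr 1
    simp [← Complex.ofReal_pow, ← Complex.ofReal_mul]
  refine h1.mono' (by
    have := continuous_inner_toEuclideanLin H
    exact (by fun_prop : Continuous _).aestronglyMeasurable) (Eventually.of_forall fun u => ?_)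
  rw [Real.norm_of_nonneg (Real.exp_pos _).le, Real.exp_le_exp]
  nlinarith [hH u]

/-- Substitution `u ↦ u / 2`. Through this scaling the Gaussian integrals below are compared with a
single one, so no determinant has to be evaluated. -/
lemma integral_exp_neg_quadratic_div_four (c : ℝ) :
    ∫ u : EuclideanSpace ℝ (Fin p), Real.exp (-(c / 4 * inner ℝ u (Matrix.toEuclideanLin H u)))
      = 2 ^ p * ∫ u : EuclideanSpace ℝ (Fin p),
        Real.exp (-(c * inner ℝ u (Matrix.toEuclideanLin H u))) := by
  have := Measure.integral_comp_smul (volume : Measure (EuclideanSpace ℝ (Fin p)))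
    (fun u => Real.exp (-(c * inner ℝ u (Matrix.toEuclideanLin H u)))) (1 / 2)
  rw [finrank_euclideanSpace_fin, abs_of_pos (by positivity)] at this
  rw [show ((2 : ℝ) ^ p) = ((1 / 2 : ℝ) ^ p)⁻¹ by simp, ← smul_eq_mul, ← this]
  congr 1
  ext u
  rw [map_smul, inner_smul_left, inner_smul_right]
  congr 1
  simp
  ring

/-- The part `b` of the exponent pays for the tail through `θ R²`; the part `c` keeps the integral
finite. -/
lemma setIntegral_exp_neg_quadratic_le (hθ : 0 < θ)
    (hH : ∀ u, θ * ‖u‖ ^ 2 ≤ inner ℝ u (Matrix.toEuclideanLin H u)) {b c R : ℝ} (hb : 0 ≤ b)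
    (hc : 0 < c) (hR : 0 ≤ R) (x₀ : EuclideanSpace ℝ (Fin p)) :
    ∫ x in {x | R ≤ ‖x - x₀‖},
        Real.exp (-((b + c) * inner ℝ (x - x₀) (Matrix.toEuclideanLin H (x - x₀))))
      ≤ Real.exp (-(b * (θ * R ^ 2))) * ∫ u : EuclideanSpace ℝ (Fin p),
        Real.exp (-(c * inner ℝ u (Matrix.toEuclideanLin H u))) := by
  have hmeas : MeasurableSet {x : EuclideanSpace ℝ (Fin p) | R ≤ ‖x - x₀‖} :=
    (isClosed_le continuous_const (by fun_prop)).measurableSet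
  have hint := ((integrable_exp_neg_quadratic hθ hH hc).comp_sub_right x₀).const_mul
    (Real.exp (-(b * (θ * R ^ 2))))
  rw [← integral_sub_right_eq_self (fun u : EuclideanSpace ℝ (Fin p) =>
    Real.exp (-(c * inner ℝ u (Matrix.toEuclideanLin H u)))) x₀, ← integral_const_mul]
  refine le_trans (setIntegral_mono_on
    ((integrable_exp_neg_quadratic hθ hH (by positivity)).comp_sub_right x₀).integrableOn
    hint.integrableOn hmeas fun x hx => ?_)
    (setIntegral_le_integral hint (Eventually.of_forall fun x => by positivity))
  rw [← Real.exp_add, Real.exp_le_exp]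
  have h1 := hH (x - x₀)
  have hx' : R ≤ ‖x - x₀‖ := hx
  have h2 : θ * R ^ 2 ≤ θ * ‖x - x₀‖ ^ 2 := by gcongr
  nlinarith

/-- Concentration of a density that is comparable to a Gaussian one on a ball. -/
lemma setIntegral_exp_neg_le_of_quadratic_bounds (hθ : 0 < θ)
    (hH : ∀ u, θ * ‖u‖ ^ 2 ≤ inner ℝ u (Matrix.toEuclideanLin H u)) {τ δ R : ℝ} (hτ : 0 < τ)
    (hR : 0 ≤ R) {xs x₀ : EuclideanSpace ℝ (Fin p)}
    {ψ : EuclideanSpace ℝ (Fin p) → ℝ} (hψ : IntegrableOn (fun x => Real.exp (-ψ x))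
      (Metric.closedBall xs δ))
    (hlow : ∀ u, x₀ + u ∈ Metric.closedBall xs δ →
      1 / (4 * τ) * inner ℝ u (Matrix.toEuclideanLin H u) ≤ ψ (x₀ + u))
    (hup : ∀ u, x₀ + u ∈ Metric.closedBall xs δ →
      ψ (x₀ + u) ≤ 3 / (4 * τ) * inner ℝ u (Matrix.toEuclideanLin H u))
    (hδ : ‖x₀ - xs‖ ≤ δ / 2) (hx₀ : ‖x₀ - xs‖ ≤ R / 2)
    (hsmall : 2 ^ p * Real.exp (-(9 / (16 * τ) * (θ * (δ / 2) ^ 2))) ≤ 1 / 2) :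
    ∫ x in Metric.closedBall xs δ ∩ {x | R ≤ ‖x - xs‖}, Real.exp (-ψ x)
      ≤ 2 ^ (p + 1) * Real.exp (-(1 / (16 * τ) * (θ * (R / 2) ^ 2)))
        * ∫ x in Metric.closedBall xs δ, Real.exp (-ψ x) := by
  have hδ0 : 0 ≤ δ / 2 := (norm_nonneg _).trans hδ
  set q : EuclideanSpace ℝ (Fin p) → ℝ := fun u => inner ℝ u (Matrix.toEuclideanLin H u) with hq
  set I := ∫ u : EuclideanSpace ℝ (Fin p), Real.exp (-(3 / (4 * τ) * q u)) with hI
  have hI0 : 0 ≤ I := integral_nonneg fun u => (Real.exp_pos _).le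
  have hint : ∀ c > 0, Integrable fun x => Real.exp (-(c * q (x - x₀))) := fun c hc =>
    (integrable_exp_neg_quadratic hθ hH hc).comp_sub_right x₀
  have hmeasR : ∀ (s : ℝ) (z : EuclideanSpace ℝ (Fin p)), MeasurableSet {x | s ≤ ‖x - z‖} :=
    fun s z => (isClosed_le continuous_const (by fun_prop)).measurableSet
  have hfour : ∀ c, ∫ u : EuclideanSpace ℝ (Fin p), Real.exp (-(c / 4 * q u))
      = 2 ^ p * ∫ u : EuclideanSpace ℝ (Fin p), Real.exp (-(c * q u)) :=
    integral_exp_neg_quadratic_div_four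
  -- the numerator
  have hN : ∫ x in Metric.closedBall xs δ ∩ {x | R ≤ ‖x - xs‖}, Real.exp (-ψ x)
      ≤ Real.exp (-(1 / (16 * τ) * (θ * (R / 2) ^ 2))) * (2 ^ p * I) :=
    calc _ ≤ ∫ x in Metric.closedBall xs δ ∩ {x | R ≤ ‖x - xs‖},
          Real.exp (-(1 / (4 * τ) * q (x - x₀))) := by
          refine setIntegral_mono_on (hψ.mono_set Set.inter_subset_left)
            (hint _ (by positivity)).integrableOn
            (Metric.isClosed_closedBall.measurableSet.inter (hmeasR R xs)) fun x hx => ?_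
          rw [Real.exp_le_exp, neg_le_neg_iff]
          have := hlow (x - x₀) (by simpa using hx.1)
          rwa [add_sub_cancel] at this
      _ ≤ ∫ x in {x | R / 2 ≤ ‖x - x₀‖}, Real.exp (-(1 / (4 * τ) * q (x - x₀))) := by
          refine setIntegral_mono_set (hint _ (by positivity)).integrableOn
            (Eventually.of_forall fun x => (Real.exp_pos _).le)
            (LE.le.eventuallyLE fun x hx => ?_)
          have h1 : R ≤ ‖x - xs‖ := hx.2
          have h2 : ‖x - xs‖ ≤ ‖x - x₀‖ + ‖x₀ - xs‖ := norm_sub_le_norm_sub_add_norm_sub _ _ _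
          change R / 2 ≤ ‖x - x₀‖
          linarith
      -- The rate splits as `1/(4τ) = 1/(16τ) + (3/(4τ))/4`, so the leftover integral is `2 ^ p *
      -- I`.
      _ ≤ Real.exp (-(1 / (16 * τ) * (θ * (R / 2) ^ 2)))
          * ∫ u, Real.exp (-(3 / (4 * τ) / 4 * q u)) := by
          have := setIntegral_exp_neg_quadratic_le hθ hH (b := 1 / (16 * τ))
            (c := 3 / (4 * τ) / 4) (R := R / 2) (by positivity) (by positivity) (by positivity) x₀
          rwa [show 1 / (16 * τ) + 3 / (4 * τ) / 4 = 1 / (4 * τ) by field_simp; norm_num] at this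
      _ = _ := by rw [hfour]
  -- the denominator
  have hout : ∫ x in {x | δ / 2 ≤ ‖x - x₀‖}, Real.exp (-(3 / (4 * τ) * q (x - x₀))) ≤ I / 2 := by
    have := setIntegral_exp_neg_quadratic_le hθ hH (b := 9 / (16 * τ))
      (c := 3 / (4 * τ) / 4) (R := δ / 2) (by positivity) (by positivity) hδ0 x₀
    rw [show 9 / (16 * τ) + 3 / (4 * τ) / 4 = 3 / (4 * τ) by field_simp; norm_num] at this
    refine this.trans ?_
    rw [hfour, ← mul_assoc, mul_comm (Real.exp _)]
    linarith [mul_le_mul_of_nonneg_right hsmall hI0]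
  have hD : I / 2 ≤ ∫ x in Metric.closedBall xs δ, Real.exp (-ψ x) := by
    have hfull : ∫ x, Real.exp (-(3 / (4 * τ) * q (x - x₀))) = I :=
      integral_sub_right_eq_self (fun u => Real.exp (-(3 / (4 * τ) * q u))) x₀
    have hsplit := integral_add_compl (hmeasR (δ / 2) x₀) (hint (3 / (4 * τ)) (by positivity))
    rw [hfull] at hsplit
    have hsub : {x | δ / 2 ≤ ‖x - x₀‖}ᶜ ⊆ Metric.closedBall xs δ := fun x hx => by
      have h1 : ‖x - x₀‖ < δ / 2 := by simpa using hx
      have h2 : ‖x - xs‖ ≤ ‖x - x₀‖ + ‖x₀ - xs‖ := norm_sub_le_norm_sub_add_norm_sub _ _ _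
      rw [Metric.mem_closedBall, dist_eq_norm]
      linarith
    calc I / 2 ≤ ∫ x in {x | δ / 2 ≤ ‖x - x₀‖}ᶜ, Real.exp (-(3 / (4 * τ) * q (x - x₀))) := by
          linarith
      _ ≤ ∫ x in {x | δ / 2 ≤ ‖x - x₀‖}ᶜ, Real.exp (-ψ x) := by
          refine setIntegral_mono_on (hint _ (by positivity)).integrableOn (hψ.mono_set hsub)
            (hmeasR _ _).compl fun x hx => ?_
          rw [Real.exp_le_exp, neg_le_neg_iff]
          have := hup (x - x₀) (by simpa using hsub hx)
          rwa [add_sub_cancel] at this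
      _ ≤ _ := setIntegral_mono_set hψ (Eventually.of_forall fun x => (Real.exp_pos _).le)
          (LE.le.eventuallyLE hsub)
  calc _ ≤ _ := hN
    _ = 2 ^ (p + 1) * Real.exp (-(1 / (16 * τ) * (θ * (R / 2) ^ 2))) * (I / 2) := by
      rw [pow_succ]
      ring
    _ ≤ _ := by gcongr

end GaussianTails

/-! ### The posterior as a normalised measure. -/

namespace InverseProblem

variable {n p : ℕ} {M : InverseProblem n p} {xs : EuclideanSpace ℝ (Fin p)}

lemma posteriorUnnormalised_apply {τ ν : ℝ} {y : EuclideanSpace ℝ (Fin n)}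
    (hint : IntegrableOn (fun x => Real.exp (-(M.h ν y x) / τ)) M.X)
    {T : Set (EuclideanSpace ℝ (Fin p))} (hT : MeasurableSet T) :
    M.posteriorUnnormalised τ ν y T
      = ENNReal.ofReal (∫ x in T ∩ M.X, Real.exp (-(M.h ν y x) / τ)) := by
  rw [posteriorUnnormalised, withDensity_apply _ hT, Measure.restrict_restrict hT,
    ofReal_integral_eq_lintegral_ofReal (hint.mono_set Set.inter_subset_right)
      (Eventually.of_forall fun x => (Real.exp_pos _).le)]

lemma setIntegral_exp_neg_h_pos {τ ν δ : ℝ} {y : EuclideanSpace ℝ (Fin n)} (hδ : 0 < δ)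
    (hint : IntegrableOn (fun x => Real.exp (-(M.h ν y x) / τ)) M.X)
    (hsub : Metric.closedBall xs δ ⊆ M.X) :
    0 < ∫ x in Metric.closedBall xs δ, Real.exp (-(M.h ν y x) / τ) := by
  rw [setIntegral_pos_iff_support_of_nonneg_ae (Eventually.of_forall fun x => (Real.exp_pos _).le)
    (hint.mono_set hsub)]
  have : Function.support (fun x => Real.exp (-(M.h ν y x) / τ)) = Set.univ := by
    ext x
    simp [Real.exp_ne_zero]
  rw [this, Set.univ_inter]
  exact Metric.measure_closedBall_pos _ _ hδ

lemma isProbabilityMeasure_posterior {τ ν δ : ℝ} {y : EuclideanSpace ℝ (Fin n)} (hδ : 0 < δ)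
    (hint : IntegrableOn (fun x => Real.exp (-(M.h ν y x) / τ)) M.X)
    (hsub : Metric.closedBall xs δ ⊆ M.X) : IsProbabilityMeasure (M.posterior τ ν y) := by
  constructor
  rw [posterior, Measure.smul_apply, smul_eq_mul]
  have hpos := setIntegral_exp_neg_h_pos hδ hint hsub
  refine ENNReal.inv_mul_cancel ?_ ?_
  · rw [posteriorUnnormalised_apply hint MeasurableSet.univ, Set.univ_inter]
    refine (ENNReal.ofReal_pos.2 (hpos.trans_le ?_)).ne'
    exact setIntegral_mono_set hint (Eventually.of_forall fun x => (Real.exp_pos _).le)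
      (LE.le.eventuallyLE hsub)
  · rw [posteriorUnnormalised_apply hint MeasurableSet.univ]
    exact ENNReal.ofReal_ne_top

lemma exp_neg_sub_div (a b τ : ℝ) :
    Real.exp (-(a - b) / τ) = Real.exp (b / τ) * Real.exp (-a / τ) := by
  rw [← Real.exp_add]
  congr 1
  ring

/-- The posterior mass of a set is at most the tail term plus the relative mass inside the ball. -/
lemma posterior_apply_le {τ ν δ κ : ℝ} {y : EuclideanSpace ℝ (Fin n)} (hδ : 0 < δ)
    (hint : IntegrableOn (fun x => Real.exp (-(M.h ν y x) / τ)) M.X)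
    (hsub : Metric.closedBall xs δ ⊆ M.X) {T : Set (EuclideanSpace ℝ (Fin p))}
    (hT : MeasurableSet T) (hκ : 0 ≤ κ)
    (hN : ∫ x in Metric.closedBall xs δ ∩ T, Real.exp (-(M.h ν y x) / τ)
      ≤ κ * ∫ x in Metric.closedBall xs δ, Real.exp (-(M.h ν y x) / τ)) :
    M.posterior τ ν y T ≤ ENNReal.ofReal
      (M.tailRatio xs τ ν δ y / (1 + M.tailRatio xs τ ν δ y) + κ) := by
  set w : EuclideanSpace ℝ (Fin p) → ℝ := fun x => Real.exp (-(M.h ν y x) / τ) with hw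
  have hw0 : ∀ x, 0 ≤ w x := fun x => (Real.exp_pos _).le
  set D := ∫ x in Metric.closedBall xs δ, w x with hD
  set O := ∫ x in M.X \ Metric.closedBall xs δ, w x with hO
  have hDpos : 0 < D := setIntegral_exp_neg_h_pos hδ hint hsub
  have hO0 : 0 ≤ O := integral_nonneg hw0
  have hBm : MeasurableSet (Metric.closedBall xs δ) := Metric.isClosed_closedBall.measurableSet
  have htotal : ∫ x in M.X, w x = O + D := by
    have := integral_inter_add_sdiff (μ := volume) (s := M.X) hBm hint
    rw [Set.inter_eq_self_of_subset_right hsub] at this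
    linarith
  -- The normalisation by `h(xs)` cancels in the quotient.
  have hratio : M.tailRatio xs τ ν δ y = O / D := by
    rw [tailRatio, Set.inter_eq_self_of_subset_right hsub]
    simp_rw [exp_neg_sub_div]
    rw [integral_const_mul, integral_const_mul]
    exact mul_div_mul_left _ _ (Real.exp_pos _).ne'
  have hmass : ∫ x in T ∩ M.X, w x ≤ O + κ * D := by
    have h1 := integral_inter_add_sdiff (μ := volume) (s := T ∩ M.X) hBm
      (hint.mono_set Set.inter_subset_right)
    have h2 : ∫ x in (T ∩ M.X) \ Metric.closedBall xs δ, w x ≤ O :=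
      setIntegral_mono_set (hint.mono_set Set.sdiff_subset) (Eventually.of_forall hw0)
        (LE.le.eventuallyLE (Set.sdiff_subset_sdiff_left Set.inter_subset_right))
    have h3 : T ∩ M.X ∩ Metric.closedBall xs δ = Metric.closedBall xs δ ∩ T := by
      rw [Set.inter_assoc, Set.inter_eq_self_of_subset_right hsub, Set.inter_comm]
    rw [h3] at h1
    linarith
  rw [posterior, Measure.smul_apply, smul_eq_mul, posteriorUnnormalised_apply hint MeasurableSet.univ,
    posteriorUnnormalised_apply hint hT, Set.univ_inter]
  change (ENNReal.ofReal (∫ x in M.X, w x))⁻¹ * ENNReal.ofReal (∫ x in T ∩ M.X, w x) ≤ _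
  rw [htotal, ← ENNReal.ofReal_inv_of_pos (by positivity),
    ← ENNReal.ofReal_mul (by positivity), hratio]
  refine ENNReal.ofReal_le_ofReal ?_
  have h4 : O / D / (1 + O / D) = O / (O + D) := by
    field_simp
    ring
  rw [h4, inv_mul_eq_div]
  calc _ ≤ (O + κ * D) / (O + D) := by gcongr
    _ = O / (O + D) + κ * (D / (O + D)) := by ring
    _ ≤ O / (O + D) + κ * 1 := by
      gcongr
      rw [div_le_one (by positivity)]
      linarith
    _ = _ := by ring

end InverseProblem

/-! ### Estimates for `s log s`. -/

section LogEstimates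

/-- `log x ≥ 1 - 1/x` at `x = s / τ` trades `log s` for `log τ` at the cost of `τ`, whatever the
size of `s`; this avoids the non-monotonicity of `s log s`. -/
lemma neg_mul_log_le {s τ : ℝ} (hs : 0 ≤ s) (hτ : 0 < τ) :
    -(s * Real.log s) ≤ s * (-Real.log τ) + τ := by
  rcases hs.eq_or_lt with rfl | hs
  · simpa using hτ.le
  have h1 := Real.one_sub_inv_le_log_of_pos (div_pos hs hτ)
  rw [Real.log_div hs.ne' hτ.ne', inv_div] at h1
  have h2 : s * (1 - τ / s) ≤ s * (Real.log s - Real.log τ) := by gcongr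
  have h3 : s * (1 - τ / s) = s - τ := by field_simp
  linarith

lemma neg_mul_log_le_one {τ : ℝ} (hτ : 0 < τ) : -(τ * Real.log τ) ≤ 1 := by
  have h1 := Real.one_sub_inv_le_log_of_pos hτ
  have h2 : τ * (1 - τ⁻¹) ≤ τ * Real.log τ := by gcongr
  have h3 : τ * (1 - τ⁻¹) = τ - 1 := by field_simp
  linarith

lemma le_neg_mul_log {s m τ : ℝ} (hms : m ≤ s) (hs : 0 < s) (hτ : 0 < τ)
    (hτ1 : τ ≤ 1) (hle : s ≤ √τ) : m * (-Real.log τ / 2) ≤ -(s * Real.log s) := by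
  have h1 : Real.log s ≤ Real.log τ / 2 := by
    rw [← Real.log_sqrt hτ.le]
    exact Real.log_le_log hs hle
  have h2 : Real.log τ ≤ 0 := Real.log_nonpos hτ.le hτ1
  calc m * (-Real.log τ / 2) ≤ s * (-Real.log τ / 2) := by
        gcongr
        linarith
    _ ≤ s * (-Real.log s) := by
        gcongr
        linarith
    _ = _ := by ring

lemma eventually_nhdsGT_zero_lt {c : ℝ} (hc : 0 < c) : ∀ᶠ τ in 𝓝[>] (0 : ℝ), τ < c :=
  (eventually_lt_nhds hc).filter_mono nhdsWithin_le_nhds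

lemma eventually_one_le_neg_log : ∀ᶠ τ in 𝓝[>] (0 : ℝ), 1 ≤ -Real.log τ := by
  filter_upwards [eventually_nhdsGT_zero_lt (Real.exp_pos (-1)), self_mem_nhdsWithin] with τ h h0
  have := (Real.log_lt_log h0 h).le
  rw [Real.log_exp] at this
  linarith

/-- Eventually `-τ log τ ≤ τ^(3/4)`, and `(3/4)(2/3) = 1/2`. It serves the ill-posed lower bound
when the variance argument exceeds `√τ`. -/
lemma eventually_rpow_neg_mul_log_le_sqrt :
    ∀ᶠ τ in 𝓝[>] (0 : ℝ), ((-(τ * Real.log τ)) ^ (1 / 3 : ℝ)) ^ 2 ≤ √τ := by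
  have h1 := (tendsto_log_mul_rpow_nhdsGT_zero (r := 1 / 4) (by norm_num)).eventually
    (lt_mem_nhds (show (-1 : ℝ) < 0 by norm_num))
  filter_upwards [h1, self_mem_nhdsWithin, eventually_one_le_neg_log] with τ h h0 hl
  have h0' : (0 : ℝ) < τ := h0
  have hL0 : 0 ≤ -(τ * Real.log τ) := by nlinarith
  have hL : -(τ * Real.log τ) ≤ τ ^ (3 / 4 : ℝ) := by
    have e1 : τ = τ ^ (3 / 4 : ℝ) * τ ^ (1 / 4 : ℝ) := by
      rw [← Real.rpow_add h0']
      norm_num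
    calc -(τ * Real.log τ) = τ ^ (3 / 4 : ℝ) * (-(Real.log τ * τ ^ (1 / 4 : ℝ))) := by
          conv_lhs => rw [show τ * Real.log τ
            = (τ ^ (3 / 4 : ℝ) * τ ^ (1 / 4 : ℝ)) * Real.log τ by rw [← e1]]
          ring
      _ ≤ τ ^ (3 / 4 : ℝ) * 1 := by
          gcongr
          linarith
      _ = _ := mul_one _
  rw [← Real.rpow_natCast, ← Real.rpow_mul hL0, Real.sqrt_eq_rpow]
  calc _ ≤ (τ ^ (3 / 4 : ℝ)) ^ ((1 / 3 : ℝ) * (2 : ℕ)) := by gcongr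
    _ = τ ^ (1 / 2 : ℝ) := by
      rw [← Real.rpow_mul h0'.le]
      norm_num

end LogEstimates

/-! ### Upper and lower bounds for the leading term. -/

namespace InverseProblem

variable {n p : ℕ} {M : InverseProblem n p} {xs : EuclideanSpace ℝ (Fin p)}
variable {Cf M₁ S₂ : Matrix (Fin n) (Fin n) ℝ} {Cg : Matrix (Fin p) (Fin p) ℝ}

/-- Uniform boundedness of `H_ν⁻¹ Aᵀ` controls both linear coefficients, because the gradient of the
prior has the form `Aᵀ z`; the trace is at most `p / θ`. -/
lemma exists_leadingBound_le (M₁ : Matrix (Fin n) (Fin n) ℝ)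
    (hg : ∃ z, gradient M.g xs = Matrix.toEuclideanLin M.Aᵀ z)
    (hV : (M.V M.yexact xs).PosDef) {ν₀ : ℝ} (hν₀ : 0 < ν₀) (hH : (M.Hnu xs ν₀).PosDef) :
    ∃ C > 0, ∀ r τ ν θ, 0 ≤ r → 0 < τ → τ ≤ 1 → 0 < ν → ν ≤ ν₀ / 2 → 0 < θ →
      (∀ u, θ * ‖u‖ ^ 2 ≤ inner ℝ u (Matrix.toEuclideanLin (M.Hnu xs ν) u)) →
      M.leadingBound xs M₁ r τ ν ≤ C * (r + ν) + √(4 * p * (-(τ * Real.log τ) / θ) + τ) := by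
  obtain ⟨C, hC, hinv⟩ := M.exists_norm_le_of_Hnu_eq hV hν₀ hH
  obtain ⟨z, hz⟩ := hg
  have hM₁ := matrixSpectralNorm_nonneg M₁
  refine ⟨C * matrixSpectralNorm M₁ + C * ‖z‖ + 2, by positivity,
    fun r τ ν θ hr hτ hτ1 hν hνle hθ hlow => ?_⟩
  have hpd := M.Hnu_posDef hV hν₀ hH hν (by linarith)
  have h1 : matrixSpectralNorm ((M.Hnu xs ν)⁻¹ * M.Aᵀ * M₁) ≤ C * matrixSpectralNorm M₁ := by
    refine matrixSpectralNorm_le (by positivity) fun u => ?_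
    rw [toEuclideanLin_mul_apply, toEuclideanLin_mul_apply]
    refine (hinv ν hν hνle (Matrix.toEuclideanLin M₁ u) _ (hpd.toEuclideanLin_inv_apply _)).trans ?_
    rw [mul_assoc]
    gcongr
    exact norm_toEuclideanLin_le _ _
  have h2 : ‖Matrix.toEuclideanLin (M.Hnu xs ν)⁻¹ (gradient M.g xs)‖ ≤ C * ‖z‖ := by
    rw [hz]
    exact hinv ν hν hνle z _ (hpd.toEuclideanLin_inv_apply _)
  have h3 : √(-(4 * τ * (M.Hnu xs ν)⁻¹.trace * Real.log (4 * τ * (M.Hnu xs ν)⁻¹.trace)))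
      ≤ √(4 * p * (-(τ * Real.log τ) / θ) + τ) := by
    refine Real.sqrt_le_sqrt ?_
    have ht0 : 0 ≤ (M.Hnu xs ν)⁻¹.trace := hpd.inv.posSemidef.trace_nonneg
    have ht := hpd.trace_inv_le hθ hlow
    refine (neg_mul_log_le (by positivity) hτ).trans ?_
    have hl : 0 ≤ -Real.log τ := by linarith [Real.log_nonpos hτ.le hτ1]
    calc _ ≤ 4 * τ * (p / θ) * (-Real.log τ) + τ := by gcongr
      _ = _ := by ring
  have h4 : 0 ≤ √(4 * p * (-(τ * Real.log τ) / θ) + τ) := Real.sqrt_nonneg _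
  have h5 : matrixSpectralNorm ((M.Hnu xs ν)⁻¹ * M.Aᵀ * M₁) * r ≤ C * matrixSpectralNorm M₁ * r := by
    gcongr
  have h6 : ‖Matrix.toEuclideanLin (M.Hnu xs ν)⁻¹ (gradient M.g xs)‖ * ν ≤ C * ‖z‖ * ν := by
    gcongr
  have e1 : 0 ≤ C * matrixSpectralNorm M₁ * r := by positivity
  have e2 : 0 ≤ C * matrixSpectralNorm M₁ * ν := by positivity
  have e3 : 0 ≤ C * ‖z‖ * r := by positivity
  have e4 : 0 ≤ C * ‖z‖ * ν := by positivity
  rw [leadingBound]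
  refine max_le ?_ ?_ <;> linarith

lemma sqrt_le_leadingBound {r τ ν : ℝ} (hr : 0 ≤ r) (hν : 0 < ν) :
    √(-(4 * τ * (M.Hnu xs ν)⁻¹.trace * Real.log (4 * τ * (M.Hnu xs ν)⁻¹.trace)))
      ≤ M.leadingBound xs M₁ r τ ν := by
  refine le_max_of_le_right ?_
  have h1 := mul_nonneg (matrixSpectralNorm_nonneg ((M.Hnu xs ν)⁻¹ * M.Aᵀ * M₁)) hr
  have h2 : 0 ≤ ‖Matrix.toEuclideanLin (M.Hnu xs ν)⁻¹ (gradient M.g xs)‖ * ν := by positivity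
  linarith

lemma norm_mul_le_leadingBound {r τ ν : ℝ} (hr : 0 ≤ r) :
    ‖Matrix.toEuclideanLin (M.Hnu xs ν)⁻¹ (gradient M.g xs)‖ * ν
      ≤ M.leadingBound xs M₁ r τ ν := by
  refine le_max_of_le_right ?_
  have h1 := mul_nonneg (matrixSpectralNorm_nonneg ((M.Hnu xs ν)⁻¹ * M.Aᵀ * M₁)) hr
  have h2 := Real.sqrt_nonneg
    (-(4 * τ * (M.Hnu xs ν)⁻¹.trace * Real.log (4 * τ * (M.Hnu xs ν)⁻¹.trace)))
  linarith

/-- Lower bound for the leading term in the well-posed case. -/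
lemma exists_le_leadingBound_of_rank_eq (M : InverseProblem n p) (xs : EuclideanSpace ℝ (Fin p))
    (M₁ : Matrix (Fin n) (Fin n) ℝ) (hp : 0 < p) (hV : (M.V M.yexact xs).PosDef)
    {ν₀ : ℝ} (hν₀ : 0 < ν₀) (hH : (M.Hnu xs ν₀).PosDef) (hrank : (M.information xs).rank = p) :
    ∃ a κ : ℝ, 0 < a ∧ 0 < κ ∧ ∀ᶠ τ in 𝓝[>] (0 : ℝ), ∀ r ν, 0 ≤ r → 0 < ν → ν < κ →
      a * (-(τ * Real.log τ)) ^ (1 / 2 : ℝ) ≤ M.leadingBound xs M₁ r τ ν := by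
  obtain ⟨c, hc, hlow⟩ := M.exists_le_inner_Hnu hV hν₀ hH
  obtain ⟨a, ha, hA⟩ := M.exists_mul_norm_le_fwd_of_rank_eq hrank
  obtain ⟨C, hC, hup⟩ := M.exists_norm_Hnu_le xs
  have hp' : (0 : ℝ) < p := by exact_mod_cast hp
  set θ := c * a ^ 2 with hθ
  have hθ0 : 0 < θ := by positivity
  -- The trace is at least `1 / C`, and half of `-log τ` survives in `-log s`: `4 · (1/C) · (1/2) =
  -- 2/C`.
  refine ⟨√(2 / C), min (ν₀ / 2) 1, by positivity, by positivity, ?_⟩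
  filter_upwards [self_mem_nhdsWithin, eventually_one_le_neg_log,
    eventually_nhdsGT_zero_lt one_pos,
    eventually_nhdsGT_zero_lt (show (0 : ℝ) < (θ / (4 * p)) ^ 2 by positivity)]
    with τ hτ hl hτ1 hτ2 r ν hr hν hνκ
  have hτ : 0 < τ := hτ
  have hν1 : ν ≤ ν₀ / 2 := hνκ.le.trans (min_le_left _ _)
  have hν2 : ν ≤ 1 := hνκ.le.trans (min_le_right _ _)
  have hpd := M.Hnu_posDef hV hν₀ hH hν (by linarith)
  have ht1 : (M.Hnu xs ν)⁻¹.trace ≤ p / θ := hpd.trace_inv_le hθ0 fun u => by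
    refine le_trans ?_ (hlow ν hν hν1 u)
    have h1 : (a * ‖u‖) ^ 2 ≤ ‖M.fwd u‖ ^ 2 := by gcongr; exact hA u
    have h2 : c * (a * ‖u‖) ^ 2 ≤ c * ‖M.fwd u‖ ^ 2 := by gcongr
    have h3 : 0 ≤ c * (ν * ‖u‖ ^ 2) := by positivity
    rw [hθ]
    linarith
  have ht2 : 1 / C ≤ (M.Hnu xs ν)⁻¹.trace := by
    set v : EuclideanSpace ℝ (Fin p) := EuclideanSpace.single ⟨0, hp⟩ 1
    have hv : ‖v‖ = 1 := by simp [v]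
    have h1 := hpd.one_le_inner_mul_trace_inv hv
    have h2 : inner ℝ v (Matrix.toEuclideanLin (M.Hnu xs ν) v) ≤ C := by
      have := (real_inner_le_norm v (Matrix.toEuclideanLin (M.Hnu xs ν) v)).trans
        (mul_le_mul_of_nonneg_left (hup ν hν hν2 v) (norm_nonneg v))
      simpa [hv] using this
    rw [div_le_iff₀ hC]
    have ht0 : 0 ≤ (M.Hnu xs ν)⁻¹.trace := hpd.inv.posSemidef.trace_nonneg
    nlinarith
  refine le_trans ?_ (sqrt_le_leadingBound hr hν)
  rw [← Real.sqrt_eq_rpow, ← Real.sqrt_mul (by positivity)]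
  refine Real.sqrt_le_sqrt ?_
  have hsτ : √τ ≤ θ / (4 * p) := Real.sqrt_le_iff.2 ⟨by positivity, hτ2.le⟩
  have hs : 4 * τ * (M.Hnu xs ν)⁻¹.trace ≤ √τ :=
    calc _ ≤ 4 * τ * (p / θ) := by gcongr
      _ = √τ * (√τ * (4 * p / θ)) := by
        conv_lhs => rw [← Real.mul_self_sqrt hτ.le]
        ring
      _ ≤ √τ * (θ / (4 * p) * (4 * p / θ)) := by gcongr
      _ = √τ := by field_simp
  have hms : 4 * τ * (1 / C) ≤ 4 * τ * (M.Hnu xs ν)⁻¹.trace := by gcongr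
  have := le_neg_mul_log hms (lt_of_lt_of_le (by positivity) hms) hτ hτ1.le hs
  calc _ = 4 * τ * (1 / C) * (-Real.log τ / 2) := by ring
    _ ≤ _ := this

/-- Lower bound for the leading term in the ill-posed case. -/
lemma exists_le_leadingBound_of_rank_lt (M : InverseProblem n p) (xs : EuclideanSpace ℝ (Fin p))
    (M₁ : Matrix (Fin n) (Fin n) ℝ) (hV : (M.V M.yexact xs).PosDef)
    {ν₀ : ℝ} (hν₀ : 0 < ν₀) (hH : (M.Hnu xs ν₀).PosDef) (hrank : (M.information xs).rank < p)
    (hg : gradient M.g xs ≠ 0) :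
    ∃ a κ : ℝ, 0 < a ∧ 0 < κ ∧ ∀ᶠ τ in 𝓝[>] (0 : ℝ), ∀ r ν, 0 ≤ r → 0 < ν → ν < κ → τ / ν < κ →
      a * (-(τ * Real.log τ)) ^ (1 / 3 : ℝ) ≤ M.leadingBound xs M₁ r τ ν := by
  obtain ⟨c, hc, hlow⟩ := M.exists_le_inner_Hnu hV hν₀ hH
  obtain ⟨k, hk1, hk⟩ := M.exists_norm_eq_one_fwd_eq_zero hV hrank
  obtain ⟨C, hC, hup⟩ := M.exists_norm_Hnu_le xs
  have hp' : (0 : ℝ) < p := by exact_mod_cast (Nat.zero_le _).trans_lt hrank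
  have hg' : 0 < ‖gradient M.g xs‖ := norm_pos_iff.2 hg
  set β := matrixSpectralNorm (hessianMatrix M.g xs) + 1 with hβ
  have hβ0 : 0 < β := by linarith [matrixSpectralNorm_nonneg (hessianMatrix M.g xs)]
  -- The two entries of the first minimum belong to the bias-dominated and the variance-dominated
  -- range. The last entry of `κ` makes `s ≤ e⁻¹`, hence `-log s ≥ 1`.
  refine ⟨min (‖gradient M.g xs‖ / C) (√(min 1 (2 / β))),
    min (min (ν₀ / 2) 1) (c * Real.exp (-1) / (4 * p)), by positivity, by positivity, ?_⟩
  filter_upwards [self_mem_nhdsWithin, eventually_one_le_neg_log,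
    eventually_nhdsGT_zero_lt one_pos, eventually_rpow_neg_mul_log_le_sqrt]
    with τ hτ hl hτ1 hτ2 r ν hr hν hνκ hτν
  have hτ : 0 < τ := hτ
  have hν1 : ν ≤ ν₀ / 2 := hνκ.le.trans ((min_le_left _ _).trans (min_le_left _ _))
  have hν2 : ν ≤ 1 := hνκ.le.trans ((min_le_left _ _).trans (min_le_right _ _))
  have hτν' : τ / ν ≤ c * Real.exp (-1) / (4 * p) := hτν.le.trans (min_le_right _ _)
  have hpd := M.Hnu_posDef hV hν₀ hH hν (by linarith)
  have hL : 0 < -(τ * Real.log τ) := by nlinarith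
  set b := (-(τ * Real.log τ)) ^ (1 / 3 : ℝ) with hb
  have hb0 : 0 < b := Real.rpow_pos_of_pos hL _
  have hb3 : b ^ 3 = -(τ * Real.log τ) := by
    rw [hb, ← Real.rpow_natCast, ← Real.rpow_mul hL.le]
    norm_num
  -- `b` is the balance point: above it the bias term alone is of order at least `b`, below it the
  -- trace term is.
  rcases le_total b ν with hbν | hbν
  · refine le_trans ?_ (norm_mul_le_leadingBound hr)
    have h1 : ‖gradient M.g xs‖ / C ≤ ‖Matrix.toEuclideanLin (M.Hnu xs ν)⁻¹ (gradient M.g xs)‖ := by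
      rw [div_le_iff₀ hC, mul_comm]
      have := hup ν hν hν2 (Matrix.toEuclideanLin (M.Hnu xs ν)⁻¹ (gradient M.g xs))
      rwa [hpd.toEuclideanLin_inv_apply] at this
    calc _ ≤ ‖gradient M.g xs‖ / C * b := by gcongr; exact min_le_left _ _
      _ ≤ _ := by gcongr
  · have ht1 : (M.Hnu xs ν)⁻¹.trace ≤ p / (c * ν) := hpd.trace_inv_le (by positivity) fun u => by
      refine le_trans ?_ (hlow ν hν hν1 u)
      have : 0 ≤ c * ‖M.fwd u‖ ^ 2 := by positivity
      linarith
    have ht2 : 1 / (β * ν) ≤ (M.Hnu xs ν)⁻¹.trace := by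
      have h1 := hpd.one_le_inner_mul_trace_inv hk1
      have h2 : inner ℝ k (Matrix.toEuclideanLin (M.Hnu xs ν) k) ≤ β * ν := by
        rw [inner_Hnu, hk, inner_zero_left, zero_add, mul_comm]
        gcongr
        have := (abs_le.1 (abs_inner_toEuclideanLin_le (hessianMatrix M.g xs) k k)).2
        rw [hk1] at this
        linarith
      rw [div_le_iff₀ (by positivity)]
      have ht0 : 0 ≤ (M.Hnu xs ν)⁻¹.trace := hpd.inv.posSemidef.trace_nonneg
      nlinarith
    set s := 4 * τ * (M.Hnu xs ν)⁻¹.trace with hs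
    have hms : 4 * τ * (1 / (β * b)) ≤ s :=
      calc 4 * τ * (1 / (β * b)) ≤ 4 * τ * (1 / (β * ν)) := by gcongr
        _ ≤ s := by rw [hs]; gcongr
    have hs0 : 0 < s := lt_of_lt_of_le (by positivity) hms
    have hse : s ≤ Real.exp (-1) :=
      calc s ≤ 4 * τ * (p / (c * ν)) := by rw [hs]; gcongr
        _ = 4 * p / c * (τ / ν) := by field_simp
        _ ≤ 4 * p / c * (c * Real.exp (-1) / (4 * p)) := by gcongr
        _ = _ := by field_simp
    refine le_trans ?_ (sqrt_le_leadingBound hr hν)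
    calc _ ≤ √(min 1 (2 / β)) * b := by gcongr; exact min_le_right _ _
      _ = √(min 1 (2 / β) * b ^ 2) := by rw [Real.sqrt_mul (by positivity), Real.sqrt_sq hb0.le]
      _ ≤ √(-(s * Real.log s)) := Real.sqrt_le_sqrt ?_
    -- For large `s` already `-s log s ≥ s ≥ √τ ≥ b²`; for small `s`, `-log s` is at least half of
    -- `-log τ`.
    rcases le_total (√τ) s with hsτ | hsτ
    · have h1 : Real.log s ≤ -1 := by
        rw [← Real.log_exp (-1)]
        exact Real.log_le_log hs0 hse
      calc _ ≤ 1 * b ^ 2 := by gcongr; exact min_le_left _ _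
        _ ≤ s := by rw [one_mul]; exact hτ2.trans hsτ
        _ ≤ _ := by nlinarith
    · have := le_neg_mul_log hms hs0 hτ hτ1.le hsτ
      calc _ ≤ 2 / β * b ^ 2 := by gcongr; exact min_le_right _ _
        _ = 2 / β * (b ^ 3 / b) := by field_simp
        _ = 4 * τ * (1 / (β * b)) * (-Real.log τ / 2) := by
          rw [hb3]
          field_simp
          ring
        _ ≤ _ := this

end InverseProblem

/-! ### Posterior concentration and the general rate theorem. -/

namespace InverseProblem

variable {n p : ℕ} {M : InverseProblem n p} {xs : EuclideanSpace ℝ (Fin p)}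
variable {Cf M₁ S₂ : Matrix (Fin n) (Fin n) ℝ} {Cg : Matrix (Fin p) (Fin p) ℝ}

/-- Concentration of the posterior distribution for observations close to the exact data. -/
lemma exists_posterior_le (M : InverseProblem n p) (xs : EuclideanSpace ℝ (Fin p))
    (Cf M₁ S₂ : Matrix (Fin n) (Fin n) ℝ) (Cg : Matrix (Fin p) (Fin p) ℝ)
    (hY : M.yexact ∈ M.Y)
    (hid : ∀ μ₀ ∈ M.fwd '' M.X, ∀ η ∈ M.fwd '' M.X, η ≠ μ₀ →
      M.ftil (M.G μ₀) μ₀ < M.ftil (M.G μ₀) η) (hxs : M.IsPriorMinimiser xs)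
    (hint : xs ∈ interior M.X) (hV : (M.V M.yexact xs).PosDef) {ν₀ : ℝ} (hν₀ : 0 < ν₀)
    (hH : (M.Hnu xs ν₀).PosDef) :
    ∃ ε > 0, ∃ C > 0, ∀ r δ ν τ θ, 0 ≤ r → 0 < δ → δ + r ≤ ε → 0 < ν → ν ≤ ν₀ / 2 →
      C * (r + ν) ≤ δ / 2 → 0 < τ → τ ≤ 1 → 0 < θ →
      (∀ u, θ * ‖u‖ ^ 2 ≤ inner ℝ u (Matrix.toEuclideanLin (M.Hnu xs ν) u)) →
      2 ^ p * Real.exp (-(9 / (16 * τ) * (θ * (δ / 2) ^ 2))) ≤ 1 / 2 →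
      Metric.closedBall xs δ ⊆ M.X →
      M.SmoothNear xs Cf Cg r δ → M.ConvergesInY xs M₁ S₂ r → ∀ y ∈ M.Yloc r,
      IntegrableOn (fun x => Real.exp (-(M.h ν y x) / τ)) M.X →
      M.posterior τ ν y {x | 2 * C * (r + ν) + 8 * √(-(τ * Real.log τ) / θ) ≤ ‖x - xs‖}
        ≤ ENNReal.ofReal (M.tailRatio xs τ ν δ y / (1 + M.tailRatio xs τ ν δ y)
          + 2 ^ (p + 1) * τ) := by
  obtain ⟨ε, hε, C, hC, hmode⟩ := M.exists_mode xs Cf M₁ S₂ Cg hY hid hxs hint hV hν₀ hH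
  refine ⟨ε, hε, C, hC, fun r δ ν τ θ hr hδ hsmall hν hνle hbias hτ hτ1 hθ hlow hexp hsub hsm hcv
    y hy hint' => ?_⟩
  obtain ⟨x₀, hx₀, hq⟩ := hmode r δ ν hr hδ hsmall hν hνle (by linarith) hsm hcv y hy
  have hlog : 0 ≤ -Real.log τ := by linarith [Real.log_nonpos hτ.le hτ1]
  have hL : 0 ≤ -(τ * Real.log τ) / θ := by
    rw [← mul_neg]
    positivity
  -- Half of `R` covers the displacement of the mode; also `(R/2)² ≥ 16 (-τ log τ) / θ`, which
  -- cancels the `1/(16τ)` in the exponent and leaves a factor at most `τ`.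
  set R := 2 * C * (r + ν) + 8 * √(-(τ * Real.log τ) / θ) with hR
  have hsq : 0 ≤ √(-(τ * Real.log τ) / θ) := Real.sqrt_nonneg _
  have hR0 : 0 ≤ R := by positivity
  have hmeas : MeasurableSet {x : EuclideanSpace ℝ (Fin p) | R ≤ ‖x - xs‖} :=
    (isClosed_le continuous_const (by fun_prop)).measurableSet
  refine posterior_apply_le hδ hint' hsub hmeas (by positivity) ?_
  have hcongr : (fun x => Real.exp (-((M.h ν y x - M.h ν y x₀) / τ)))
      = fun x => Real.exp (M.h ν y x₀ / τ) * Real.exp (-(M.h ν y x) / τ) := by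
    ext x
    rw [← exp_neg_sub_div, neg_div]
  have hmain := setIntegral_exp_neg_le_of_quadratic_bounds (τ := τ) (δ := δ) (R := R) (xs := xs)
    (x₀ := x₀) (ψ := fun x => (M.h ν y x - M.h ν y x₀) / τ) hθ hlow hτ hR0
    (by rw [hcongr]; exact (hint'.mono_set hsub).const_mul _)
    (fun u hu => by
      rw [le_div_iff₀ hτ]
      refine le_trans (le_of_eq ?_) (hq u hu).1
      field_simp)
    (fun u hu => by
      rw [div_le_iff₀ hτ]
      refine (hq u hu).2.trans (le_of_eq ?_)
      field_simp)
    (hx₀.trans hbias) (hx₀.trans (by linarith)) hexp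
  rw [hcongr, integral_const_mul, integral_const_mul, mul_left_comm] at hmain
  refine (le_of_mul_le_mul_left hmain (Real.exp_pos _)).trans ?_
  have hpos := setIntegral_exp_neg_h_pos hδ hint' hsub
  gcongr
  rw [← Real.log_le_log_iff (Real.exp_pos _) hτ, Real.log_exp]
  have h1 : 4 * √(-(τ * Real.log τ) / θ) ≤ R / 2 := by
    have : 0 ≤ C * (r + ν) := by positivity
    linarith
  have h2 : (4 * √(-(τ * Real.log τ) / θ)) ^ 2 ≤ (R / 2) ^ 2 := by gcongr
  rw [mul_pow, Real.sq_sqrt hL] at h2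
  have h3 : 1 / (16 * τ) * (θ * (4 ^ 2 * (-(τ * Real.log τ) / θ)))
      ≤ 1 / (16 * τ) * (θ * (R / 2) ^ 2) := by gcongr
  have h4 : 1 / (16 * τ) * (θ * (4 ^ 2 * (-(τ * Real.log τ) / θ))) = -Real.log τ := by
    field_simp
    norm_num
  linarith

lemma measure_notMem_Yloc_le {Ω : Type*} [MeasurableSpace Ω] {P : Measure Ω}
    [IsProbabilityMeasure P] {m : Measure (EuclideanSpace ℝ (Fin n))}
    {f : EuclideanSpace ℝ (Fin n) → ℝ≥0∞} {ξ : Ω → EuclideanSpace ℝ (Fin n)} (hξ : Measurable ξ)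
    (hlaw : P.map ξ = m.withDensity f) (hm : m M.Yᶜ = 0) :
    P {ω | ξ ω ∉ M.Yloc (kyFanDist P dist ξ (fun _ => M.yexact))}
      ≤ ENNReal.ofReal (kyFanDist P dist ξ (fun _ => M.yexact)) := by
  have h1 : P {ω | ξ ω ∉ M.Y} = 0 := by
    -- `M.Y` need not be measurable, so the inequality for image measures is used.
    refine le_antisymm ((Measure.le_map_apply hξ.aemeasurable M.Yᶜ).trans ?_) zero_le
    rw [hlaw]
    exact (withDensity_absolutelyContinuous m f hm).le
  refine (measure_mono fun ω hω => ?_).trans ((measure_union_le _ _).trans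
    ((add_le_add h1.le measure_kyFanDist_lt_le).trans_eq (zero_add _)))
  by_cases hy : ξ ω ∈ M.Y
  · right
    simp only [Yloc, Set.mem_ofPred_eq, not_and, not_le] at hω ⊢
    rw [dist_eq_norm]
    exact hω hy
  · exact Or.inl hy

/-- The convergence rate of the posterior distribution, in terms of a lower bound `θ` for the
eigenvalues of `H_ν`. -/
theorem exists_kyFanDist_posterior_le {Ω : Type*} [MeasurableSpace Ω] {P : Measure Ω}
    [IsProbabilityMeasure P]
    {refm : ℝ → Measure (EuclideanSpace ℝ (Fin n))} {c : ℝ → EuclideanSpace ℝ (Fin n) → ℝ}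
    {obs : ℝ → Ω → EuclideanSpace ℝ (Fin n)} {ν δ ρ θ b : ℝ → ℝ} (hδ : ∀ τ, 0 < δ τ)
    (hρ : ∀ τ, ρ τ = kyFanDist P dist (obs τ) (fun _ => M.yexact))
    (hmodel : M.IsModel P refm c obs)
    (hproper : ∀ᶠ τ in 𝓝[>] (0 : ℝ), ∀ y ∈ M.Y,
      IntegrableOn (fun x => Real.exp (-(M.h (ν τ) y x) / τ)) M.X)
    (hxs : M.IsPriorMinimiser xs) (hxs_int : xs ∈ interior M.X)
    (hsmooth : ∀ᶠ τ in 𝓝[>] (0 : ℝ), M.SmoothNear xs Cf Cg (ρ τ) (δ τ))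
    (hconv : ∀ᶠ τ in 𝓝[>] (0 : ℝ), M.ConvergesInY xs M₁ S₂ (ρ τ))
    (hV : (M.V M.yexact xs).PosDef) {ν₀ : ℝ} (hν₀ : 0 < ν₀) (hH : (M.Hnu xs ν₀).PosDef)
    (hν : ∀ᶠ τ in 𝓝[>] (0 : ℝ), 0 < ν τ ∧ ν τ ≤ ν₀ / 2)
    (hδ_zero : Tendsto δ (𝓝[>] 0) (𝓝 0))
    (hρ_zero : Tendsto ρ (𝓝[>] 0) (𝓝 0))
    (hδ_bias : Tendsto (fun τ => (ρ τ + ν τ) / δ τ) (𝓝[>] 0) (𝓝 0))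
    {K : ℝ} (hnegl : ∀ᶠ τ in 𝓝[>] (0 : ℝ), ∀ y ∈ M.Yloc (ρ τ),
      M.tailRatio xs τ (ν τ) (δ τ) y / (1 + M.tailRatio xs τ (ν τ) (δ τ) y)
        ≤ K * M.leadingBound xs M₁ (ρ τ) τ (ν τ))
    (hθ : ∀ᶠ τ in 𝓝[>] (0 : ℝ), 0 < θ τ ∧
      ∀ u, θ τ * ‖u‖ ^ 2 ≤ inner ℝ u (Matrix.toEuclideanLin (M.Hnu xs (ν τ)) u))
    (hθδ : Tendsto (fun τ => θ τ * δ τ ^ 2 / τ) (𝓝[>] 0) atTop)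
    {B : ℝ} (hB : 0 < B) (hb : ∀ᶠ τ in 𝓝[>] (0 : ℝ), 0 < b τ ∧ ρ τ + ν τ ≤ B * b τ ∧
      -(τ * Real.log τ) / θ τ ≤ B * b τ ^ 2 ∧ τ ≤ b τ ∧ τ ≤ b τ ^ 2) :
    ∃ C > 0, ∀ᶠ τ in 𝓝[>] (0 : ℝ), M.leadingBound xs M₁ (ρ τ) τ (ν τ) ≤ C * b τ ∧
      kyFanDist P levyProkhorovDist (fun ω => M.posterior τ (ν τ) (obs τ ω))
        (fun _ => Measure.dirac M.xtrue) ≤ ‖M.xtrue - xs‖ + C * b τ := by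
  have hgrad : ∃ z, gradient M.g xs = Matrix.toEuclideanLin M.Aᵀ z := by
    obtain ⟨τ, hτ⟩ := hsmooth.exists
    exact hxs.exists_gradient_eq hxs_int ((hτ.contDiffAt_g xs
      (Metric.mem_closedBall_self (hδ τ).le)).differentiableAt (by norm_num))
  obtain ⟨C₁, hC₁, hlead⟩ := exists_leadingBound_le M₁ hgrad hV hν₀ hH
  obtain ⟨ε, hε, C₂, hC₂, hpost⟩ := M.exists_posterior_le xs Cf M₁ S₂ Cg hmodel.yexact_mem
    hmodel.identifiable hxs hxs_int hV hν₀ hH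
  set D := C₁ * B + √(4 * p * B + 1) with hD
  have hD0 : 0 < D := by positivity
  -- The summands pay in turn for the leading bound, for `ρ`, for the concentration radius and for
  -- the posterior mass beyond it.
  set E := D + B + (2 * C₂ * B + 8 * √B) + (|K| * D + 2 ^ (p + 1)) with hE
  refine ⟨E, by positivity, ?_⟩
  have hsub : ∀ᶠ τ in 𝓝[>] (0 : ℝ), Metric.closedBall xs (δ τ) ⊆ M.X := by
    obtain ⟨ε', hε', hball⟩ := Metric.mem_nhds_iff.1 (mem_interior_iff_mem_nhds.1 hxs_int)
    filter_upwards [hδ_zero.eventually (gt_mem_nhds hε')] with τ h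
    exact (Metric.closedBall_subset_ball h).trans hball
  have hsmall : ∀ᶠ τ in 𝓝[>] (0 : ℝ), δ τ + ρ τ < ε := by
    have := hδ_zero.add hρ_zero
    rw [add_zero] at this
    exact this.eventually (gt_mem_nhds hε)
  have hbias : ∀ᶠ τ in 𝓝[>] (0 : ℝ), C₂ * (ρ τ + ν τ) ≤ δ τ / 2 := by
    filter_upwards [hδ_bias.eventually (gt_mem_nhds (show 0 < 1 / (2 * C₂) by positivity))]
      with τ h
    rw [div_lt_iff₀ (hδ τ)] at h
    calc _ ≤ C₂ * (1 / (2 * C₂) * δ τ) := by gcongr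
      _ = _ := by field_simp
  have hexp : ∀ᶠ τ in 𝓝[>] (0 : ℝ),
      2 ^ p * Real.exp (-(9 / (16 * τ) * (θ τ * (δ τ / 2) ^ 2))) ≤ 1 / 2 := by
    have h1 : Tendsto (fun τ => 2 ^ p * Real.exp (-(9 / 64 * (θ τ * δ τ ^ 2 / τ)))) (𝓝[>] 0)
        (𝓝 (2 ^ p * 0)) :=
      (Real.tendsto_exp_neg_atTop_nhds_zero.comp
        (hθδ.const_mul_atTop (by norm_num))).const_mul _
    rw [mul_zero] at h1
    filter_upwards [h1.eventually (gt_mem_nhds (show (0 : ℝ) < 1 / 2 by norm_num))] with τ h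
    refine le_trans (le_of_eq ?_) h.le
    congr 3
    ring
  filter_upwards [hproper, hsmooth, hconv, hν, hnegl, hθ, hb, hsub, hsmall, hbias, hexp,
    self_mem_nhdsWithin, eventually_nhdsGT_zero_lt one_pos, hmodel.refm_compl,
    hmodel.measurable_obs, hmodel.law_obs] with τ hproper hsmooth hconv hν hnegl hθ hb hsub hsmall
      hbias hexp hτ hτ1 hrefm hobs hlaw
  have hτ : 0 < τ := hτ
  have hρ0 : 0 ≤ ρ τ := by
    rw [hρ]
    exact kyFanDist_nonneg
  obtain ⟨hb0, hb1, hb2, hb3, hb4⟩ := hb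
  have hU : M.leadingBound xs M₁ (ρ τ) τ (ν τ) ≤ D * b τ := by
    refine (hlead (ρ τ) τ (ν τ) (θ τ) hρ0 hτ hτ1.le hν.1 hν.2 hθ.1 hθ.2).trans ?_
    have h1 : √(4 * p * (-(τ * Real.log τ) / θ τ) + τ) ≤ √(4 * p * B + 1) * b τ := by
      rw [← Real.sqrt_sq hb0.le, ← Real.sqrt_mul (by positivity)]
      refine Real.sqrt_le_sqrt ?_
      calc _ ≤ 4 * p * (B * b τ ^ 2) + b τ ^ 2 := by gcongr
        _ = _ := by ring
    calc _ ≤ C₁ * (B * b τ) + √(4 * p * B + 1) * b τ := by gcongr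
      _ = _ := by rw [hD]; ring
  have hnn : 0 ≤ 2 * C₂ * B + 8 * √B := by positivity
  have hnn2 : 0 ≤ |K| * D + 2 ^ (p + 1) := by positivity
  refine ⟨hU.trans (by gcongr; linarith), ?_⟩
  set s := ‖M.xtrue - xs‖ + E * b τ with hs
  have hnorm := norm_nonneg (M.xtrue - xs)
  have hEb : E * b τ = D * b τ + B * b τ + (2 * C₂ * B + 8 * √B) * b τ
      + (|K| * D + 2 ^ (p + 1)) * b τ := by rw [hE]; ring
  have hDb : 0 < D * b τ := by positivity
  have hBb : 0 < B * b τ := by positivity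
  have hb5 : 0 ≤ (2 * C₂ * B + 8 * √B) * b τ := by positivity
  have hb6 : 0 ≤ (|K| * D + 2 ^ (p + 1)) * b τ := by positivity
  have hs0 : 0 < s := by linarith
  -- The same `s` bounds the radius about `xtrue` and the mass outside it, as the Prokhorov distance
  -- requires.
  have hLP : ∀ y ∈ M.Yloc (ρ τ),
      levyProkhorovDist (M.posterior τ (ν τ) y) (Measure.dirac M.xtrue) ≤ s := by
    intro y hy
    have := isProbabilityMeasure_posterior (hδ τ) (hproper y hy.1) hsub
    refine levyProkhorovDist_dirac_le _ hs0.le ?_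
    refine (measure_mono fun x hx => ?_).trans ((hpost (ρ τ) (δ τ) (ν τ) τ (θ τ) hρ0 (hδ τ)
      hsmall.le hν.1 hν.2 hbias hτ hτ1.le hθ.1 hθ.2 hexp hsub hsmooth hconv y hy
      (hproper y hy.1)).trans (ENNReal.ofReal_le_ofReal ?_))
    · have hx' : s ≤ dist x M.xtrue := hx
      rw [dist_eq_norm] at hx'
      have h1 : ‖x - M.xtrue‖ ≤ ‖x - xs‖ + ‖xs - M.xtrue‖ := norm_sub_le_norm_sub_add_norm_sub _ _ _
      rw [norm_sub_rev xs] at h1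
      have h2 : √(-(τ * Real.log τ) / θ τ) ≤ √B * b τ := by
        rw [← Real.sqrt_sq hb0.le, ← Real.sqrt_mul hB.le]
        exact Real.sqrt_le_sqrt hb2
      have h3 : 2 * C₂ * (ρ τ + ν τ) ≤ 2 * C₂ * (B * b τ) := by gcongr
      rw [Set.mem_ofPred_eq]
      linarith
    · have h1 : K * M.leadingBound xs M₁ (ρ τ) τ (ν τ) ≤ |K| * (D * b τ) := by
        have h2 : 0 ≤ M.leadingBound xs M₁ (ρ τ) τ (ν τ) :=
          (Real.sqrt_nonneg _).trans (sqrt_le_leadingBound hρ0 hν.1)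
        calc _ ≤ |K| * M.leadingBound xs M₁ (ρ τ) τ (ν τ) := by
              gcongr
              exact le_abs_self K
          _ ≤ _ := by gcongr
      have h3 : (2 : ℝ) ^ (p + 1) * τ ≤ 2 ^ (p + 1) * b τ := by gcongr
      linarith [hnegl y hy]
  refine kyFanDist_le hs0 ?_
  have h1 := measure_notMem_Yloc_le (M := M) hobs hlaw hrefm
  rw [← hρ] at h1
  refine (measure_mono fun ω hω => ?_).trans_lt (h1.trans_lt ?_)
  · intro hmem
    exact absurd (hLP _ hmem) (not_le.2 hω)
  · rw [ENNReal.ofReal_lt_ofReal_iff hs0]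
    linarith [hν.1]

end InverseProblem

/-! ### Choice of the prior scale, and the theorem. -/

/-- With `l = -log τ`, the scale `γ² = τ^t l^(-s)` yields `ν = τ / γ² = (τ l)^s`; used for `s = 1/2`
and `s = 1/3`. -/
lemma mul_rpow_mul_rpow_neg_eq {τ l s t : ℝ} (hτ : 0 < τ) (hl : 0 < l) (hst : s + t = 1) :
    (τ * l) ^ s * (τ ^ t * l ^ (-s)) = τ := by
  rw [Real.mul_rpow hτ.le hl.le]
  calc _ = (τ ^ s * τ ^ t) * (l ^ s * l ^ (-s)) := by ring
    _ = τ := by rw [← Real.rpow_add hτ, ← Real.rpow_add hl, hst]; simp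

theorem mainTheorem4 {n p : ℕ} (M : InverseProblem n p)
    {Ω : Type*} [MeasurableSpace Ω] (P : Measure Ω) [IsProbabilityMeasure P]
    (refm : ℝ → Measure (EuclideanSpace ℝ (Fin n))) (c : ℝ → EuclideanSpace ℝ (Fin n) → ℝ)
    (obs : ℝ → Ω → EuclideanSpace ℝ (Fin n))
    -- the prior scale, the ratio `ν = τ / γ ^ 2`, and the radius of the local neighbourhood
    (γ ν δ : ℝ → ℝ) (hγ : ∀ τ, 0 < γ τ) (hν : ∀ τ, ν τ = τ / γ τ ^ 2) (hδ : ∀ τ, 0 < δ τ)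
    -- the Ky Fan distance between the data and the exact data
    (ρ : ℝ → ℝ) (hρ : ∀ τ, ρ τ = kyFanDist P dist (obs τ) (fun _ => M.yexact))
    (xs : EuclideanSpace ℝ (Fin p))
    (Cf M₁ S₂ : Matrix (Fin n) (Fin n) ℝ) (Cg : Matrix (Fin p) (Fin p) ℝ)
    (hCf : Cf.PosDef) (hCg : Cg.PosDef) (hM₁ : M₁.PosDef) (hS₂ : S₂.PosDef)
    -- the Bayesian model
    (hmodel : M.IsModel P refm c obs)
    -- the posterior distribution is proper
    (hproper : ∀ᶠ τ in 𝓝[>] (0 : ℝ), ∀ y ∈ M.Y,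
      IntegrableOn (fun x => Real.exp (-(M.h (ν τ) y x) / τ)) M.X)
    -- the point of concentration
    (hxs : M.IsPriorMinimiser xs) (hxs_int : xs ∈ interior M.X)
    -- smoothness of the likelihood and the prior
    (hsmooth : ∀ᶠ τ in 𝓝[>] (0 : ℝ), M.SmoothNear xs Cf Cg (ρ τ) (δ τ))
    (hconv : ∀ᶠ τ in 𝓝[>] (0 : ℝ), M.ConvergesInY xs M₁ S₂ (ρ τ))
    (hV : (M.V M.yexact xs).PosDef)
    (hH : ∀ᶠ τ in 𝓝[>] (0 : ℝ), (M.Hnu xs (ν τ)).PosDef)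
    -- the local neighbourhood
    (hδ_zero : Tendsto δ (𝓝[>] 0) (𝓝 0))
    (hδ_sqrt : Tendsto (fun τ => δ τ / √τ) (𝓝[>] 0) atTop)
    (hδ_bias : Tendsto (fun τ => (ρ τ + ν τ) / δ τ) (𝓝[>] 0) (𝓝 0))
    (hδ_gamma : (M.Aᵀ * M.A).rank < p → Tendsto (fun τ => δ τ / γ τ) (𝓝[>] 0) atTop)
    (htail : ∀ ε > 0, ∀ᶠ τ in 𝓝[>] (0 : ℝ), ∀ y ∈ M.Yloc (ρ τ),
      M.tailRatio xs τ (ν τ) (δ τ) y ≤ ε)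
    -- the rate of the data, and negligibility of the tail term
    (C : ℝ) (hrate : ∀ᶠ τ in 𝓝[>] (0 : ℝ), ρ τ ≤ C * √(-(τ * Real.log τ)))
    (K : ℝ) (hnegl : ∀ᶠ τ in 𝓝[>] (0 : ℝ), ∀ y ∈ M.Yloc (ρ τ),
      M.tailRatio xs τ (ν τ) (δ τ) y / (1 + M.tailRatio xs τ (ν τ) (δ τ) y)
        ≤ K * M.leadingBound xs M₁ (ρ τ) τ (ν τ)) :
    -- well-posed case
    ((M.information xs).rank = p →
      ((∀ᶠ τ in 𝓝[>] (0 : ℝ),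
          τ ^ (1 / 2 : ℝ) * (-Real.log τ) ^ (-(1 / 2) : ℝ) ≤ γ τ ^ 2) →
        ∃ C₁ : ℝ, 0 < C₁ ∧ ∀ᶠ τ in 𝓝[>] (0 : ℝ),
          M.leadingBound xs M₁ (ρ τ) τ (ν τ) ≤ C₁ * (-(τ * Real.log τ)) ^ (1 / 2 : ℝ) ∧
          kyFanDist P levyProkhorovDist (fun ω => M.posterior τ (ν τ) (obs τ ω))
              (fun _ => Measure.dirac M.xtrue)
            ≤ C₁ * (-(τ * Real.log τ)) ^ (1 / 2 : ℝ)) ∧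
      -- no other choice of the prior scale gives an upper bound of smaller order
      (0 < p → ∃ a κ : ℝ, 0 < a ∧ 0 < κ ∧ ∀ᶠ τ in 𝓝[>] (0 : ℝ),
        ∀ ν' : ℝ, 0 < ν' → ν' < κ →
          a * (-(τ * Real.log τ)) ^ (1 / 2 : ℝ) ≤ M.leadingBound xs M₁ (ρ τ) τ ν')) ∧
    -- ill-posed case
    ((M.information xs).rank < p →
      ((∀ᶠ τ in 𝓝[>] (0 : ℝ),
          γ τ ^ 2 = τ ^ (2 / 3 : ℝ) * (-Real.log τ) ^ (-(1 / 3) : ℝ)) →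
        ∃ C₂ : ℝ, 0 < C₂ ∧ ∀ᶠ τ in 𝓝[>] (0 : ℝ),
          M.leadingBound xs M₁ (ρ τ) τ (ν τ) ≤ C₂ * (-(τ * Real.log τ)) ^ (1 / 3 : ℝ) ∧
          kyFanDist P levyProkhorovDist (fun ω => M.posterior τ (ν τ) (obs τ ω))
              (fun _ => Measure.dirac M.xtrue)
            ≤ ‖(M.xtrue - xs) - M.PA (M.xtrue - xs)‖
              + C₂ * (-(τ * Real.log τ)) ^ (1 / 3 : ℝ)) ∧
      -- no other choice of the prior scale gives an upper bound of smaller order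
      (gradient M.g xs ≠ 0 → ∃ a κ : ℝ, 0 < a ∧ 0 < κ ∧ ∀ᶠ τ in 𝓝[>] (0 : ℝ),
        ∀ ν' : ℝ, 0 < ν' → ν' < κ → τ / ν' < κ →
          a * (-(τ * Real.log τ)) ^ (1 / 3 : ℝ) ≤ M.leadingBound xs M₁ (ρ τ) τ ν')) := by
  -- consequences of the assumptions for small `τ`
  have hνpos : ∀ τ, 0 < τ → 0 < ν τ := fun τ hτ => by
    rw [hν]
    exact div_pos hτ (pow_pos (hγ τ) 2)
  have hρ0 : ∀ τ, 0 ≤ ρ τ := fun τ => by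
    rw [hρ]
    exact kyFanDist_nonneg
  -- One admissible value of `ν` is frozen; every uniform constant is taken relative to it.
  obtain ⟨ν₀, hν₀, hH₀⟩ : ∃ ν₀ > 0, (M.Hnu xs ν₀).PosDef := by
    obtain ⟨τ, hτ, hτ0⟩ := (hH.and self_mem_nhdsWithin).exists
    exact ⟨ν τ, hνpos τ hτ0, hτ⟩
  have hsum : Tendsto (fun τ => ρ τ + ν τ) (𝓝[>] 0) (𝓝 0) := by
    have := hδ_bias.mul hδ_zero
    rw [mul_zero] at this
    exact this.congr fun τ => div_mul_cancel₀ _ (hδ τ).ne'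
  have hpos : ∀ᶠ τ in 𝓝[>] (0 : ℝ), 0 < τ := self_mem_nhdsWithin
  have hρ_zero : Tendsto ρ (𝓝[>] 0) (𝓝 0) :=
    squeeze_zero' (Eventually.of_forall hρ0)
      (hpos.mono fun τ hτ => by linarith [hνpos τ hτ]) hsum
  have hν_zero : Tendsto ν (𝓝[>] 0) (𝓝 0) :=
    squeeze_zero' (hpos.mono fun τ hτ => (hνpos τ hτ).le)
      (Eventually.of_forall fun τ => by linarith [hρ0 τ]) hsum
  have hνle : ∀ᶠ τ in 𝓝[>] (0 : ℝ), 0 < ν τ ∧ ν τ ≤ ν₀ / 2 := by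
    filter_upwards [hpos, hν_zero.eventually (gt_mem_nhds (half_pos hν₀))] with τ h1 h2
    exact ⟨hνpos τ h1, h2.le⟩
  obtain ⟨c', hc', hlow⟩ := M.exists_le_inner_Hnu hV hν₀ hH₀
  refine ⟨fun hrank => ⟨fun hγle => ?_, fun hp => ?_⟩, fun hrank => ⟨fun hγeq => ?_, fun hg => ?_⟩⟩
  · obtain ⟨a, ha, hA⟩ := M.exists_mul_norm_le_fwd_of_rank_eq hrank
    have hxx : M.xtrue = xs := by
      have h1 := hA (M.xtrue - xs)
      rw [InverseProblem.fwd_sub, hxs.2.1, sub_self, norm_zero] at h1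
      have h2 : ‖M.xtrue - xs‖ ≤ 0 := by nlinarith [norm_nonneg (M.xtrue - xs)]
      exact sub_eq_zero.1 (norm_le_zero_iff.1 h2)
    -- `θ` is constant because `A` is injective. The summands of `B` absorb `ρ`, `ν` and the
    -- variance term respectively.
    obtain ⟨D, hD, h⟩ := InverseProblem.exists_kyFanDist_posterior_le (θ := fun _ => c' * a ^ 2)
      (b := fun τ => (-(τ * Real.log τ)) ^ (1 / 2 : ℝ)) (B := |C| + 1 + 1 / (c' * a ^ 2)) hδ hρ
      hmodel hproper hxs hxs_int hsmooth hconv hV hν₀ hH₀ hνle hδ_zero hρ_zero hδ_bias hnegl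
      (by
        filter_upwards [hνle] with τ hτ
        refine ⟨by positivity, fun u => le_trans ?_ (hlow (ν τ) hτ.1 hτ.2 u)⟩
        have h1 : (a * ‖u‖) ^ 2 ≤ ‖M.fwd u‖ ^ 2 := by gcongr; exact hA u
        have h2 : c' * (a * ‖u‖) ^ 2 ≤ c' * ‖M.fwd u‖ ^ 2 := by gcongr
        have h3 : 0 ≤ c' * (ν τ * ‖u‖ ^ 2) := mul_nonneg hc'.le (mul_nonneg hτ.1.le (by positivity))
        linarith)
      (by
        have h1 := ((tendsto_pow_atTop two_ne_zero).comp hδ_sqrt).const_mul_atTop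
          (show 0 < c' * a ^ 2 by positivity)
        refine h1.congr' ?_
        filter_upwards [hpos] with τ hτ
        rw [Function.comp_apply, div_pow, Real.sq_sqrt hτ.le]
        ring)
      (by positivity)
      (by
        filter_upwards [hpos, eventually_one_le_neg_log, eventually_nhdsGT_zero_lt one_pos, hrate,
          hγle] with τ hτ hl hτ1 hrate hγle
        have hL : τ ≤ -(τ * Real.log τ) := by nlinarith
        have hL0 : 0 < -(τ * Real.log τ) := hτ.trans_le hL
        have hb0 : 0 < (-(τ * Real.log τ)) ^ (1 / 2 : ℝ) := Real.rpow_pos_of_pos hL0 _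
        have hb2 : ((-(τ * Real.log τ)) ^ (1 / 2 : ℝ)) ^ 2 = -(τ * Real.log τ) := by
          rw [← Real.sqrt_eq_rpow, Real.sq_sqrt hL0.le]
        have hνb : ν τ ≤ (-(τ * Real.log τ)) ^ (1 / 2 : ℝ) := by
          rw [hν, div_le_iff₀ (pow_pos (hγ τ) 2)]
          calc τ = (-(τ * Real.log τ)) ^ (1 / 2 : ℝ)
                * (τ ^ (1 / 2 : ℝ) * (-Real.log τ) ^ (-(1 / 2) : ℝ)) := by
                rw [← mul_neg]
                exact (mul_rpow_mul_rpow_neg_eq hτ (by linarith) (by norm_num)).symm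
            _ ≤ _ := by gcongr
        have hρb : ρ τ ≤ |C| * (-(τ * Real.log τ)) ^ (1 / 2 : ℝ) := by
          rw [← Real.sqrt_eq_rpow]
          refine hrate.trans ?_
          gcongr
          exact le_abs_self C
        refine ⟨hb0, ?_, ?_, ?_, hL.trans hb2.ge⟩
        · have : 0 ≤ 1 / (c' * a ^ 2) * (-(τ * Real.log τ)) ^ (1 / 2 : ℝ) := by positivity
          linarith
        · rw [hb2, div_eq_mul_one_div, mul_comm]
          gcongr
          linarith [abs_nonneg C]
        · refine le_of_sq_le_sq ?_ hb0.le
          rw [hb2]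
          nlinarith)
    refine ⟨D, hD, h.mono fun τ hτ => ⟨hτ.1, ?_⟩⟩
    simpa only [hxx, sub_self, norm_zero, zero_add] using hτ.2
  · obtain ⟨a, κ, ha, hκ, h⟩ := M.exists_le_leadingBound_of_rank_eq xs M₁ hp hV hν₀ hH₀ hrank
    exact ⟨a, κ, ha, hκ, h.mono fun τ hτ ν' => hτ (ρ τ) ν' (hρ0 τ)⟩
  · obtain ⟨k, hk1, hk⟩ := M.exists_norm_eq_one_fwd_eq_zero hV hrank
    have hAA := M.rank_transpose_mul_self_lt hk1 hk
    have hPA : M.PA (M.xtrue - xs) = 0 := M.PA_apply_eq_zero (by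
      rw [InverseProblem.fwd_sub, hxs.2.1, sub_self])
    rw [hPA, sub_zero]
    -- Only `θ = c' ν` is available here; then `θ δ² / τ = c' (δ / γ)²`, which is where `δ / γ → ∞`
    -- enters.
    refine InverseProblem.exists_kyFanDist_posterior_le (θ := fun τ => c' * ν τ)
      (b := fun τ => (-(τ * Real.log τ)) ^ (1 / 3 : ℝ)) (B := |C| + 1 + 1 / c') hδ hρ
      hmodel hproper hxs hxs_int hsmooth hconv hV hν₀ hH₀ hνle hδ_zero hρ_zero hδ_bias hnegl
      ?_ ?_ (by positivity) ?_
    · filter_upwards [hνle] with τ hτ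
      refine ⟨mul_pos hc' hτ.1, fun u => le_trans ?_ (hlow (ν τ) hτ.1 hτ.2 u)⟩
      have : 0 ≤ c' * ‖M.fwd u‖ ^ 2 := by positivity
      linarith
    · have h1 := ((tendsto_pow_atTop two_ne_zero).comp (hδ_gamma hAA)).const_mul_atTop hc'
      refine h1.congr' ?_
      filter_upwards [hpos] with τ hτ
      have := hγ τ
      rw [Function.comp_apply, hν]
      field_simp
    · filter_upwards [hpos, eventually_one_le_neg_log, eventually_nhdsGT_zero_lt one_pos, hrate,
        hγeq] with τ hτ hl hτ1 hrate hγeq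
      have hL : τ ≤ -(τ * Real.log τ) := by nlinarith
      have hL0 : 0 < -(τ * Real.log τ) := hτ.trans_le hL
      have hL1 : -(τ * Real.log τ) ≤ 1 := neg_mul_log_le_one hτ
      have hνb : ν τ = (-(τ * Real.log τ)) ^ (1 / 3 : ℝ) := by
        have hγ' : τ ^ (2 / 3 : ℝ) * (-Real.log τ) ^ (-(1 / 3) : ℝ) ≠ 0 := by
          rw [← hγeq]
          exact (pow_pos (hγ τ) 2).ne'
        rw [hν, hγeq, div_eq_iff hγ', ← mul_neg]
        exact (mul_rpow_mul_rpow_neg_eq hτ (by linarith) (by norm_num)).symm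
      set b := (-(τ * Real.log τ)) ^ (1 / 3 : ℝ) with hb
      have hb0 : 0 < b := Real.rpow_pos_of_pos hL0 _
      have hb1 : b ≤ 1 := Real.rpow_le_one hL0.le hL1 (by norm_num)
      have hb3 : b ^ 3 = -(τ * Real.log τ) := by
        rw [hb, ← Real.rpow_natCast, ← Real.rpow_mul hL0.le]
        norm_num
      have hb4 : b ^ 3 ≤ b ^ 2 := pow_le_pow_of_le_one hb0.le hb1 (by norm_num)
      have hb5 : b ^ 3 ≤ b := pow_le_of_le_one hb0.le hb1 (by norm_num)
      have hρb : ρ τ ≤ |C| * b := by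
        refine hrate.trans ?_
        rw [Real.sqrt_eq_rpow]
        calc _ ≤ |C| * (-(τ * Real.log τ)) ^ (1 / 2 : ℝ) := by gcongr; exact le_abs_self C
          _ ≤ |C| * b := by
            gcongr ?_ * ?_
            exact Real.rpow_le_rpow_of_exponent_ge hL0 hL1 (by norm_num)
      refine ⟨hb0, ?_, ?_, ?_, ?_⟩
      · have : 0 ≤ 1 / c' * b := by positivity
        rw [hνb]
        linarith
      · rw [hνb, ← hb3]
        -- The prescribed scale makes `ν` equal to `b`, so variance and squared bias are both of
        -- order `b²`.
        calc b ^ 3 / (c' * b) = 1 / c' * b ^ 2 := by field_simp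
          _ ≤ _ := by
            gcongr
            linarith [abs_nonneg C]
      · linarith
      · linarith
  · obtain ⟨a, κ, ha, hκ, h⟩ := M.exists_le_leadingBound_of_rank_lt xs M₁ hV hν₀ hH₀ hrank hg
    exact ⟨a, κ, ha, hκ, h.mono fun τ hτ ν' => hτ (ρ τ) ν' (hρ0 τ)⟩
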